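/- **Nets.** A multi reversing Petri net consists of finite sets $P$ of places, $T$ of transitions, $A$ of token types and $A_V$ of variables, each $v\in A_V$ with a type in $A$; a set $B$ of undirected bond types; and arc labels $F(x,t),F(t,x)\subseteq A_V\cup(A_V\times A_V)$ for $x\in P$, $t\in T$, where pairs are undirected bonds, have bond types in $B$, and $(u,v)\in F(\cdot,\cdot)$ implies that $u,v$ lie in the same label. Put $\mathrm{guard}(t)=\bigcup_xF(x,t)$, $\mathrm{effects}(t)=\bigcup_xF(t,x)$. The net is well-formed: $\mathrm{guard}(t)\cap A_V=\mathrm{effects}(t)\cap A_V$, and no variable lies in both $F(t,x)$ and $F(t,y)$ for $x\ne y$. Token instances are $(a,*,i)$ ($a\in A$, $i\in\mathbb N$) and, recursively, $(\alpha,k,u)$ with $\alpha$ a token instance, $k\in\mathbb N$, $u\in A_V\cup\{*\}$; write $\alpha\mathrel{\overline\in}\beta$ if $\beta$ is $\alpha$ with zero or more further memories. A state $\langle M,H\rangle$ consists of a marking $M$ (a set of token instances and undirected bonds between them in each place) and a history $H:T\to2^{\mathbb N}$. Initially $H_0(t)=\emptyset$ for all $t$, tokens in $M_0$ are of the form $(a,*,i)$,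 each in at most one place, and each bond in $M_0(x)$ has a type in $B$ and joins tokens of $M_0(x)$. Let $\mathrm{con}(\alpha,C)$ be the set of the tokens connected to $\alpha$ by bonds in $C$ together with these bonds, $\mathrm{pre}(t,U)=U(\mathrm{guard}(t))$, $\mathrm{post}(t,U)=U(\mathrm{effects}(t))$. All assignments $U$ below are injective and type-preserving from the variables of $t$ to token instances. **Forward.** $t$ fires via $U$ if $U(F(x,t))\subseteq M(x)$ for all $x$; for variables $u,v\in F(x,t)$, $(U(u),U(v))\in M(x)$ implies $(u,v)\in F(x,t)$; and for $u\in F(t,y_1)$, $v\in F(t,y_2)$, $y_1\ne y_2$ and every $x$ with $F(x,t)\neq\emptyset$, $U(u)\notin\mathrm{con}(U(v),(M(x)\setminus\mathrm{pre}(t,U))\cup\mathrm{post}(t,U))$. With $k=1+\max(\{0\}\cup\bigcup_{t'}H(t'))$, firing removes $\bigcup_{u\in F(x,t)}\mathrm{con}(U(u),M(x))$ from each place $x$ and then adds to it $\bigcup_{u\in F(t,x),\,U(u)\in M(y)}\mathrm{con}(U(u),(M(y)\setminus\mathrm{pre}(t,U))\cup\mathrm{post}(t,U))$, where every token $\alpha$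 is replaced by $(\alpha,k,u)$ if $\alpha=U(u)$ and by $(\alpha,k,*)$ if $\alpha$ is not in the image of $U$; and $k$ is added to $H(t)$. **Backtracking and causal reversal.** Let $k\in H(t)$. $(t,k)$ is bt-enabled (respectively c-enabled) if $k$ is the largest key in $H$ (respectively there are no $t'$, $k'\in H(t')$ with $k'>k$ such that some token in $M$ has memories with both keys $k$ and $k'$) and there is $U$ such that, for all $x$, $U(F(t,x))\subseteq M(x)$ and each $U(u)$, $u\in F(t,x)$, is of the form $(\alpha,k,u)$. Then $\langle M,H\rangle\rightsquigarrow_{b}^{(t,k)}\langle M',H'\rangle$ (respectively $\rightsquigarrow_{c}^{(t,k)}$), where $H'$ is $H$ with $k$ removed from $H(t)$, and $M'(x)$ arises from $M(x)$ by removing $\bigcup_{u\in F(t,x)}\mathrm{con}(U(u),M(x))$ and adding $\bigcup_{u\in F(x,t),\,U(u)\in M(y)}\mathrm{con}(U(u),(M(y)\setminus\mathrm{post}(t,U))\cup\mathrm{pre}(t,U))$, where every token $(\alpha,k,u)$ is replaced by $\alpha$. **Out-of-causal reversal.** For a set $C$ of instances, let $\mathrm{last}_T(C,H)$ be the $(t',l)$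 with $l\in H(t')$ of largest key such that $(\beta,l,v)\mathrel{\overline\in}\alpha$ for some token $\alpha\in C$ and $v\ne*$, and $\bot$ if there is none. Let $\mathrm{last}_P(C,H)$ be the unique place $y$ such that $(\beta,l,v)\mathrel{\overline\in}\alpha\in C$ with $v\in F(t',y)$ if $\mathrm{last}_T(C,H)=(t',l)$; the place $x$ with $C\subseteq M_0(x)$ after erasing all memories in $C$ if $\mathrm{last}_T(C,H)=\bot$; and undefined if there is no such place. Let $k\in H(t)$. $(t,k)$ is o-enabled via $U$ if each $U(u)$ is a token in $M$ with $(\alpha,k,u)\mathrel{\overline\in}U(u)$ for some $\alpha$, $(U(u),U(v))$ is a bond in $M$ for every $(u,v)\in\mathrm{effects}(t)$, and whenever $(\alpha,k',u')\mathrel{\overline\in}U(u)$, $(\beta,k',v')\mathrel{\overline\in}U(v)$ with $u',v'\ne *$, $k'>k$, $k'\in H(t')$: if $(u,v)\in\mathrm{guard}(t)\setminus\mathrm{effects}(t)$ then $(u',v')\notin\mathrm{effects}(t')\setminus\mathrm{guard}(t')$, and if $(u,v)\in\mathrm{effects}(t)\setminus\mathrm{guard}(t)$ then $(u',v')\notin\mathrm{guard}(t')\setminus\mathrm{effects}(t')$.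 Then $\langle M,H\rangle\rightsquigarrow_{o}^{(t,k)}\langle M',H'\rangle$ with $H'$ as before and $M'$ as follows. For a token $\alpha$ in $M$ put $C_\alpha=\mathrm{con}(\alpha,(\bigcup_zM(z)\setminus\mathrm{post}(t,U))\cup\mathrm{pre}(t,U))$. The memory update of a token of $C_\alpha$ removes all memories later than $\mathrm{last}_T(C_\alpha,H')$ and the memory with key $k$; if $\mathrm{last}_T(C_\alpha,H')=\bot$, it removes all memories. From each place $x$, remove $\mathrm{post}(t,U)$ and all $C_\alpha$ with $\alpha\in M(x)$ such that $\mathrm{last}_P(C_\alpha,H')\ne x$ or some memory in $C_\alpha$ is changed by the update; then add, with updated memories, all $C_\alpha$ with $\mathrm{last}_P(C_\alpha,H')=x$. **Claim.** Let $\langle M,H\rangle$ be a state reached from $\langle M_0,H_0\rangle$ by forward steps and causal reversals. 1. If $(t,k)$ is c-enabled in $\langle M,H\rangle$, then for every state $\langle M',H'\rangle$: $\langle M,H\rangle\rightsquigarrow_{c}^{(t,k)}\langle M',H'\rangle$ if and only if $\langle M,H\rangle\rightsquigarrow_{o}^{(t,k)}\langle M',H'\rangle$. 2. If $(t,k)$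 is bt-enabled in $\langle M,H\rangle$, then for every state $\langle M',H'\rangle$: $\langle M,H\rangle\rightsquigarrow_{b}^{(t,k)}\langle M',H'\rangle$ if and only if $\langle M,H\rangle\rightsquigarrow_{o}^{(t,k)}\langle M',H'\rangle$. 3. Hence, as labelled relations with such states as sources, $\rightsquigarrow_b\;\subseteq\;\rightsquigarrow_c\;\subseteq\;\rightsquigarrow_o$ for every well-formed net and initial marking, and there are a well-formed net and an initial marking for which both inclusions are strict. -/

import Mathlib

/-- Elements of `X ∪ (X × X)`, with pairs read as undirected bonds: either a stand-alone element
of `X`, or a bond between two elements of `X`. Used both for arc labels (`X` = token variables) and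
for the contents of places (`X` = token instances). -/
inductive Item (X : Type*) where
  | tok (a : X) : Item X
  | bond (b : Sym2 X) : Item X

/-- Apply a function to an element, or to both ends of a bond. -/
def Item.map {X Y : Type*} (f : X → Y) : Item X → Item Y
  | .tok a => .tok (f a)
  | .bond b => .bond (b.map f)

/-- Token instances over token types `A` and variables `V`: `init a i` is the initial token
`(a, *, i)`, and `step a k u` is `(a, k, u)`, the token `a` after taking part in the transition
occurrence with key `k`, as variable `u`, or passively if `u = none` (written `*`). -/
inductive TokenInst (A V : Type*) where
  | init (a : A) (i : ℕ) : TokenInst A V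
  | step (a : TokenInst A V) (k : ℕ) (u : Option V) : TokenInst A V

namespace TokenInst

variable {A V : Type*}

/-- The type of a token instance. -/
def type : TokenInst A V → A
  | init a _ => a
  | step a _ _ => a.type

/-- `a.EvolvesTo b`: `b` is `a` with zero or more further memories. -/
inductive EvolvesTo : TokenInst A V → TokenInst A V → Prop where
  | refl (a : TokenInst A V) : EvolvesTo a a
  | step {a b : TokenInst A V} (k : ℕ) (u : Option V) :
      EvolvesTo a b → EvolvesTo a (TokenInst.step b k u)

/-- The initial token `(a, *, i)` from which a token instance has evolved. -/
def origin : TokenInst A V → TokenInst A V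
  | init a i => init a i
  | step a _ _ => a.origin

/-- Discard the outermost memories whose key is larger than `l`. -/
def truncate (l : ℕ) : TokenInst A V → TokenInst A V
  | init a i => init a i
  | step a k u => if k ≤ l then step a k u else a.truncate l

/-- Discard the memory with key `k`, if there is one, and keep all the others. -/
def forget (k : ℕ) : TokenInst A V → TokenInst A V
  | init a i => init a i
  | step a l u => if l = k then a.forget k else step (a.forget k) l u

end TokenInst

section Connected

variable {X : Type*}

/-- One step of a path of bonds in `C`. -/
def BondStep (C : Set (Item X)) (a b : X) : Prop :=
  Item.bond s(a, b) ∈ C ∧ Item.tok b ∈ C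

/-- The tokens connected to `a` by a sequence of bonds in `C`, and the bonds on such sequences. -/
def connected (a : X) (C : Set (Item X)) : Set (Item X) :=
  {e | e = Item.tok a ∧ Item.tok a ∈ C} ∪
    {e | ∃ b c, Relation.ReflTransGen (BondStep C) a b ∧ BondStep C b c ∧
      (e = Item.bond s(b, c) ∨ e = Item.tok b ∨ e = Item.tok c)}

end Connected

/-- A multi reversing Petri net with places `P`, transitions `T`, token types `A` and token
variables `V`. `arcIn x t` and `arcOut t x` are the labels of the arcs from `x` to `t` and from `t` to
`x`. The bonds on an arc connect variables on that arc, and are of the bond types of the net. -/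
structure MRPN (P T A V : Type*) where
  type : V → A
  B : Set (Sym2 A)
  arcIn : P → T → Set (Item V)
  arcOut : T → P → Set (Item V)
  arcIn_bond : ∀ x t u v, Item.bond s(u, v) ∈ arcIn x t →
    Item.tok u ∈ arcIn x t ∧ Item.tok v ∈ arcIn x t ∧ s(type u, type v) ∈ B
  arcOut_bond : ∀ t x u v, Item.bond s(u, v) ∈ arcOut t x →
    Item.tok u ∈ arcOut t x ∧ Item.tok v ∈ arcOut t x ∧ s(type u, type v) ∈ B

namespace MRPN

/-- A marking assigns to each place a set of token and bond instances. -/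
abbrev Marking (P A V : Type*) := P → Set (Item (TokenInst A V))

/-- A history assigns to each transition the keys of its occurrences not reversed so far. -/
abbrev History (T : Type*) := T → Set ℕ

/-- A state `⟨M, H⟩`. -/
@[ext] structure State (P T A V : Type*) where
  M : Marking P A V
  H : History T

variable {P T A V : Type*} (N : MRPN P T A V)

/-- The union of the labels on the incoming arcs of `t`. -/
def guard (t : T) : Set (Item V) := ⋃ x, N.arcIn x t

/-- The union of the labels on the outgoing arcs of `t`. -/
def effects (t : T) : Set (Item V) := ⋃ x, N.arcOut t x

/-- Well-formedness: transitions neither create nor erase tokens, and do not clone them. -/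
def WellFormed : Prop :=
  ∀ t, (∀ u, Item.tok u ∈ N.guard t ↔ Item.tok u ∈ N.effects t) ∧
    ∀ x y u, x ≠ y → ¬ (Item.tok u ∈ N.arcOut t x ∧ Item.tok u ∈ N.arcOut t y)

/-- An initial marking: all tokens are of the form `(a, *, i)`, no token occurs in two places, and
bonds are of the bond types of the net and connect tokens of the place that they are in. -/
def IsInitialMarking (M₀ : Marking P A V) : Prop :=
  (∀ x a, Item.tok a ∈ M₀ x → ∃ b i, a = TokenInst.init b i) ∧
  (∀ x y a, Item.tok a ∈ M₀ x → Item.tok a ∈ M₀ y → x = y) ∧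
  (∀ x a b, Item.bond s(a, b) ∈ M₀ x →
    Item.tok a ∈ M₀ x ∧ Item.tok b ∈ M₀ x ∧ s(a.type, b.type) ∈ N.B)

/-- The selected instances according to the incoming arcs of `t`. -/
def pre (t : T) (U : V → TokenInst A V) : Set (Item (TokenInst A V)) :=
  Item.map U '' N.guard t

/-- The selected instances according to the outgoing arcs of `t`. -/
def post (t : T) (U : V → TokenInst A V) : Set (Item (TokenInst A V)) :=
  Item.map U '' N.effects t

/-! ### Forward execution -/

/-- `U` is a forward enabling assignment of `t` in `s`. Only the values of `U` at the variables of
`t` matter. -/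
def FwdAssignment (s : State P T A V) (t : T) (U : V → TokenInst A V) : Prop :=
  Set.InjOn U {u | Item.tok u ∈ N.guard t} ∧
  (∀ x u, Item.tok u ∈ N.arcIn x t → Item.tok (U u) ∈ s.M x ∧ N.type u = (U u).type) ∧
  (∀ x u v, Item.bond s(u, v) ∈ N.arcIn x t → Item.bond s(U u, U v) ∈ s.M x) ∧
  (∀ x u v, Item.tok u ∈ N.arcIn x t → Item.tok v ∈ N.arcIn x t →
    Item.bond s(U u, U v) ∈ s.M x → Item.bond s(u, v) ∈ N.arcIn x t) ∧
  (∀ y₁ y₂ u v, Item.tok u ∈ N.arcOut t y₁ → Item.tok v ∈ N.arcOut t y₂ → y₁ ≠ y₂ →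
    ∀ x, (N.arcIn x t).Nonempty →
      Item.tok (U u) ∉ connected (U v) ((s.M x \ N.pre t U) ∪ N.post t U))

/-- The instances taken from place `x` by the firing of `t`. -/
def fwdIn (s : State P T A V) (t : T) (U : V → TokenInst A V) (x : P) :
    Set (Item (TokenInst A V)) :=
  {e | ∃ u, Item.tok u ∈ N.arcIn x t ∧ e ∈ connected (U u) (s.M x)}

/-- The instances, before their memories are extended, put into place `x` by the firing of `t`. -/
def fwdOut (s : State P T A V) (t : T) (U : V → TokenInst A V) (x : P) :
    Set (Item (TokenInst A V)) :=
  {e | ∃ u y, Item.tok u ∈ N.arcOut t x ∧ Item.tok (U u) ∈ s.M y ∧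
    e ∈ connected (U u) ((s.M y \ N.pre t U) ∪ N.post t U)}

open Classical in
/-- The variable of `t` to which `U` assigns the token `a`, or `none` if there is no such one. -/
noncomputable def varOf (t : T) (U : V → TokenInst A V) (a : TokenInst A V) : Option V :=
  if h : ∃ u, Item.tok u ∈ N.guard t ∧ U u = a then some h.choose else none

/-- Forward execution of `t` with the key `k`. -/
def FwdStep (s : State P T A V) (t : T) (k : ℕ) (s' : State P T A V) : Prop :=
  (∃ m, IsGreatest ({0} ∪ {l | ∃ t', l ∈ s.H t'}) m ∧ k = m + 1) ∧
  (∃ U, N.FwdAssignment s t U ∧ ∀ x, s'.M x = (s.M x \ N.fwdIn s t U x) ∪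
    Item.map (fun a => TokenInst.step a k (N.varOf t U a)) '' N.fwdOut s t U x) ∧
  (∀ t' l, l ∈ s'.H t' ↔ l ∈ s.H t' ∨ (t' = t ∧ l = k))

/-! ### Backtracking and causal-order reversal -/

/-- `(t, k)` is a transition occurrence in `s`. -/
def Occurs (s : State P T A V) (t : T) (k : ℕ) : Prop := k ∈ s.H t

/-- The history after the reversal of `(t, k)`. -/
def revHistory (H : History T) (t : T) (k : ℕ) : History T :=
  fun t' => {l | l ∈ H t' ∧ ¬ (t' = t ∧ l = k)}

/-- `U` assigns to the variables of `t` token instances, in the outgoing places of `t`, whose last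
memory is the participation in the occurrence `(t, k)` as that variable, bonded as required by the
outgoing arcs. -/
def RevAssignment (s : State P T A V) (t : T) (k : ℕ) (U : V → TokenInst A V) : Prop :=
  Set.InjOn U {u | Item.tok u ∈ N.effects t} ∧
  (∀ x u, Item.tok u ∈ N.arcOut t x → (∃ a, U u = TokenInst.step a k (some u)) ∧
    Item.tok (U u) ∈ s.M x ∧ N.type u = (U u).type) ∧
  (∀ x u v, Item.bond s(u, v) ∈ N.arcOut t x → Item.bond s(U u, U v) ∈ s.M x)

/-- The instances taken from place `x` by the reversal of `t`. -/
def revIn (s : State P T A V) (t : T) (U : V → TokenInst A V) (x : P) :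
    Set (Item (TokenInst A V)) :=
  {e | ∃ u, Item.tok u ∈ N.arcOut t x ∧ e ∈ connected (U u) (s.M x)}

/-- The instances, before their memories are reduced, put into place `x` by the reversal of `t`. -/
def revOut (s : State P T A V) (t : T) (U : V → TokenInst A V) (x : P) :
    Set (Item (TokenInst A V)) :=
  {e | ∃ u y, Item.tok u ∈ N.arcIn x t ∧ Item.tok (U u) ∈ s.M y ∧
    e ∈ connected (U u) ((s.M y \ N.post t U) ∪ N.pre t U)}

/-- The marking after backtracking or causal-order reversal of `(t, k)` with assignment `U`. -/
def revMarking (s : State P T A V) (t : T) (k : ℕ) (U : V → TokenInst A V) : Marking P A V :=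
  fun x => (s.M x \ N.revIn s t U x) ∪
    ({e | ∃ a u, e = Item.tok a ∧ Item.tok (TokenInst.step a k u) ∈ N.revOut s t U x} ∪
     {e | ∃ a b u v, e = Item.bond s(a, b) ∧
        Item.bond s(TokenInst.step a k u, TokenInst.step b k v) ∈ N.revOut s t U x})

/-- `U` is a backtracking enabling assignment of `(t, k)` in `s`. -/
def BtAssignment (s : State P T A V) (t : T) (k : ℕ) (U : V → TokenInst A V) : Prop :=
  (Occurs s t k ∧ ∀ t' k', Occurs s t' k' → k' ≤ k) ∧ N.RevAssignment s t k U

/-- `(t, k)` is bt-enabled in `s`. -/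
def BtEnabled (s : State P T A V) (t : T) (k : ℕ) : Prop := ∃ U, N.BtAssignment s t k U

/-- Backtracking of `(t, k)`. -/
def BtStep (s : State P T A V) (t : T) (k : ℕ) (s' : State P T A V) : Prop :=
  ∃ U, N.BtAssignment s t k U ∧ s'.M = N.revMarking s t k U ∧ s'.H = revHistory s.H t k

/-- `(t', k')` causally depends on `(t, k)` in `s`: some token took part in both. -/
def CausallyPrecedes (s : State P T A V) (t : T) (k : ℕ) (t' : T) (k' : ℕ) : Prop :=
  Occurs s t k ∧ Occurs s t' k' ∧ k < k' ∧
  ∃ x a, Item.tok a ∈ s.M x ∧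
    (∃ b u, (TokenInst.step b k u).EvolvesTo a) ∧ (∃ b u, (TokenInst.step b k' u).EvolvesTo a)

/-- `U` is a causal enabling assignment of `(t, k)` in `s`. -/
def CAssignment (s : State P T A V) (t : T) (k : ℕ) (U : V → TokenInst A V) : Prop :=
  (Occurs s t k ∧ ¬ ∃ t' k', CausallyPrecedes s t k t' k') ∧ N.RevAssignment s t k U

/-- `(t, k)` is c-enabled in `s`. -/
def CEnabled (s : State P T A V) (t : T) (k : ℕ) : Prop := ∃ U, N.CAssignment s t k U

/-- Causal-order reversal of `(t, k)`. -/
def CStep (s : State P T A V) (t : T) (k : ℕ) (s' : State P T A V) : Prop :=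
  ∃ U, N.CAssignment s t k U ∧ s'.M = N.revMarking s t k U ∧ s'.H = revHistory s.H t k

/-! ### Out-of-causal-order reversal -/

/-- `U` is an out-of-causal-order enabling assignment of `(t, k)` in `s`. The last two clauses say
that the breaking, respectively the creation, of a bond by `(t, k)` has not been undone by a later
occurrence. -/
def OAssignment (s : State P T A V) (t : T) (k : ℕ) (U : V → TokenInst A V) : Prop :=
  Occurs s t k ∧
  Set.InjOn U {u | Item.tok u ∈ N.effects t} ∧
  (∀ u, Item.tok u ∈ N.effects t → (∃ a, (TokenInst.step a k (some u)).EvolvesTo (U u)) ∧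
    (∃ y, Item.tok (U u) ∈ s.M y) ∧ N.type u = (U u).type) ∧
  (∀ u v, Item.bond s(u, v) ∈ N.effects t → ∃ y, Item.bond s(U u, U v) ∈ s.M y) ∧
  (∀ u v, Item.bond s(u, v) ∈ N.guard t → Item.bond s(u, v) ∉ N.effects t →
    ∀ a b k' u' v', (TokenInst.step a k' (some u')).EvolvesTo (U u) →
      (TokenInst.step b k' (some v')).EvolvesTo (U v) →
      ¬ ∃ t', k' ∈ s.H t' ∧ k < k' ∧
        Item.bond s(u', v') ∈ N.effects t' ∧ Item.bond s(u', v') ∉ N.guard t') ∧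
  (∀ u v, Item.bond s(u, v) ∈ N.effects t → Item.bond s(u, v) ∉ N.guard t →
    ∀ a b k' u' v', (TokenInst.step a k' (some u')).EvolvesTo (U u) →
      (TokenInst.step b k' (some v')).EvolvesTo (U v) →
      ¬ ∃ t', k' ∈ s.H t' ∧ k < k' ∧
        Item.bond s(u', v') ∈ N.guard t' ∧ Item.bond s(u', v') ∉ N.effects t')

/-- `(t, k)` is o-enabled in `s`. -/
def OEnabled (s : State P T A V) (t : T) (k : ℕ) : Prop := ∃ U, N.OAssignment s t k U

/-- The occurrence `(t, k)`, not reversed, has actively manipulated a token of `C`. -/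
def Manipulates (C : Set (Item (TokenInst A V))) (H : History T) (t : T) (k : ℕ) : Prop :=
  k ∈ H t ∧ ∃ a b u, Item.tok a ∈ C ∧ (TokenInst.step b k (some u)).EvolvesTo a

/-- `IsLastT C H L`: `L` is the last occurrence in `H` that has actively manipulated a token of
`C`; `none` stands for the absence of such an occurrence. -/
def IsLastT (C : Set (Item (TokenInst A V))) (H : History T) : Option (T × ℕ) → Prop
  | some (t, k) => Manipulates C H t k ∧ ¬ ∃ t' k', k < k' ∧ Manipulates C H t' k'
  | none => ¬ ∃ t k, Manipulates C H t k

/-- `IsLastP M₀ C H x`: `x` is the unique outgoing place of the last occurrence that manipulated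
`C`, at a variable that this occurrence assigned to a token of `C`; or, if there is no such
occurrence, the place in which `C` existed, with the memories of its tokens erased, in the initial
marking. -/
def IsLastP (M₀ : Marking P A V) (C : Set (Item (TokenInst A V))) (H : History T) (x : P) : Prop :=
  (∃ t k, IsLastT C H (some (t, k)) ∧
    {y | ∃ a b u, Item.tok a ∈ C ∧ (TokenInst.step b k (some u)).EvolvesTo a ∧
      Item.tok u ∈ N.arcOut t y} = {x}) ∨
  (IsLastT C H none ∧ ∀ e ∈ C, Item.map TokenInst.origin e ∈ M₀ x)

/-- The component of `a` once the effect of `t` on the selected instances has been undone. -/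
def component (s : State P T A V) (t : T) (U : V → TokenInst A V) (a : TokenInst A V) :
    Set (Item (TokenInst A V)) :=
  connected a (({e | ∃ c z, e ∈ connected c (s.M z)} \ N.post t U) ∪ N.pre t U)

/-- The memory update of a token, on the reversal of an occurrence with key `k`, in a component
last manipulated by `L`: the memories later than `L`, and the memory with key `k`, are removed; if
there is no `L`, the token becomes the initial one. -/
def lastA (L : Option (T × ℕ)) (k : ℕ) (a : TokenInst A V) : TokenInst A V :=
  match L with
  | some (_, l) => (a.truncate l).forget k
  | none => a.origin

/-- The instances removed from place `x`: the instances selected by `t`, the components that do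
not belong to `x` any more, and the components some memory of which is updated. -/
def oIn (M₀ : Marking P A V) (s : State P T A V) (t : T) (k : ℕ) (U : V → TokenInst A V) (x : P) :
    Set (Item (TokenInst A V)) :=
  N.post t U ∪
    {e | ∃ a, Item.tok a ∈ s.M x ∧ e ∈ N.component s t U a ∧
      (¬ N.IsLastP M₀ (N.component s t U a) (revHistory s.H t k) x ∨
        ∃ L, IsLastT (N.component s t U a) (revHistory s.H t k) L ∧
          ∃ b, Item.tok b ∈ N.component s t U a ∧ lastA L k b ≠ b)}

/-- The instances put into place `x`: the components that belong to `x`, with memories updated. -/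
def oOut (M₀ : Marking P A V) (s : State P T A V) (t : T) (k : ℕ) (U : V → TokenInst A V) (x : P) :
    Set (Item (TokenInst A V)) :=
  {e | ∃ a y L, Item.tok a ∈ s.M y ∧
    IsLastT (N.component s t U a) (revHistory s.H t k) L ∧
    N.IsLastP M₀ (N.component s t U a) (revHistory s.H t k) x ∧
    e ∈ Item.map (lastA L k) '' N.component s t U a}

/-- Out-of-causal-order reversal of `(t, k)`. -/
def OStep (M₀ : Marking P A V) (s : State P T A V) (t : T) (k : ℕ) (s' : State P T A V) : Prop :=
  ∃ U, N.OAssignment s t k U ∧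
    (∀ x, s'.M x = (s.M x \ N.oIn M₀ s t k U x) ∪ N.oOut M₀ s t k U x) ∧
    s'.H = revHistory s.H t k

/-! ### Executions and transition relations -/

/-- The initial state: no transition has occurred. -/
def initialState (M₀ : Marking P A V) : State P T A V := ⟨M₀, fun _ => ∅⟩

/-- `s` is reached from the initial state by an execution that consists of forward steps and
causal-order reversals. -/
def Reachable (M₀ : Marking P A V) (s : State P T A V) : Prop :=
  Relation.ReflTransGen (fun s₁ s₂ => ∃ t k, N.FwdStep s₁ t k s₂ ∨ N.CStep s₁ t k s₂)
    (initialState M₀) s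

/-- The labelled transition relation of backtracking, on reachable states. -/
def btRel (M₀ : Marking P A V) : Set (State P T A V × (T × ℕ) × State P T A V) :=
  {r | N.Reachable M₀ r.1 ∧ N.BtStep r.1 r.2.1.1 r.2.1.2 r.2.2}

/-- The labelled transition relation of causal-order reversal, on reachable states. -/
def cRel (M₀ : Marking P A V) : Set (State P T A V × (T × ℕ) × State P T A V) :=
  {r | N.Reachable M₀ r.1 ∧ N.CStep r.1 r.2.1.1 r.2.1.2 r.2.2}

/-- The labelled transition relation of out-of-causal-order reversal, on reachable states. -/
def oRel (M₀ : Marking P A V) : Set (State P T A V × (T × ℕ) × State P T A V) :=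
  {r | N.Reachable M₀ r.1 ∧ N.OStep M₀ r.1 r.2.1.1 r.2.1.2 r.2.2}

end MRPN

/-! If an occurrence `(t, k)` has no causal successors, then causal reversal and out-of-causal
reversal both produce the state in which `(t, k)` has never happened, so they agree. Backtracking is
the case of the largest key, which cannot have causal successors.

A firing is described by its local effect: the components `W` of the selected tokens become `W'`
when the bonds of the guard are exchanged for those of the effects (`Switch`, `Firing`). Forward
enabledness makes this exchange invertible and keeps the parts sent to different places disconnected
(`FwdAssignment.firing`). `Gapped` collects the states reached by firings alone, with keys that
increase but may skip values. Later firings touch no token carrying `k` when `(t, k)` has no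
successors, so undoing it commutes with them, and `unfire` is `Gapped` again (`Gapped.undoable`).
Since causal reversal computes `unfire` (`Undoable.revMarking_eq`), every reachable state is
`Gapped` (`Reachable.gapped`) and satisfies the invariant `Regular`.

For out-of-causal reversal, `redo` sends the tokens of the unfired state injectively onto those of
`s`, and the graph whose components the reversal uses is the image of the unfired state under `redo`
(`Undoable.exchange_eq`). Components therefore correspond. The reversed history does not see the
memory `k`, the invariant identifies the last place of a component with its place in the unfired
state (`Regular.isLastP_iff`), and the memory update inverts `redo` (`Undoable.lastA_redo`). So this
reversal computes `unfire` too (`Undoable.oMarking_eq`).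

Strictness is witnessed by `chain`: two independent moves separate backtracking from causal
reversal, and two successive moves of one token separate causal from out-of-causal reversal. -/

namespace Item

/-! ### Tokens and bonds under maps. -/

variable {X Y Z : Type*}

/-- The element itself, or the two ends of a bond. -/
def ends : Item X → Set X
  | tok a => {a}
  | bond b => {x | x ∈ b}

@[simp] theorem mem_ends_tok {a b : X} : b ∈ (tok a).ends ↔ b = a := Iff.rfl

@[simp] theorem mem_ends_bond {a : X} {b : Sym2 X} : a ∈ (bond b).ends ↔ a ∈ b := Iff.rfl

theorem ends_nonempty : ∀ e : Item X, e.ends.Nonempty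
  | tok a => ⟨a, rfl⟩
  | bond b => by
    induction b with
    | h a b => exact ⟨a, Sym2.mem_mk_left a b⟩

@[simp] theorem map_tok (f : X → Y) (a : X) : (tok a).map f = tok (f a) := rfl

@[simp] theorem map_bond (f : X → Y) (a b : X) :
    (bond s(a, b)).map f = bond s(f a, f b) := rfl

theorem mem_ends_map {f : X → Y} {e : Item X} {b : Y} :
    b ∈ (e.map f).ends ↔ ∃ a ∈ e.ends, f a = b := by
  cases e with
  | tok a => simp [eq_comm]
  | bond p => simp [Item.map, Sym2.mem_map]

theorem map_congr {f g : X → Y} {e : Item X} (h : ∀ a ∈ e.ends, f a = g a) :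
    e.map f = e.map g := by
  cases e with
  | tok a => simp [h a rfl]
  | bond p => exact congrArg bond (Sym2.map_congr h)

theorem map_map (f : X → Y) (g : Y → Z) (e : Item X) : (e.map f).map g = e.map (g ∘ f) := by
  cases e with
  | tok a => rfl
  | bond p => simp [Item.map, Sym2.map_map]

theorem map_eq_self {f : X → X} {e : Item X} (h : ∀ a ∈ e.ends, f a = a) : e.map f = e := by
  rw [map_congr (g := id) h]
  cases e with
  | tok a => rfl
  | bond p => simp [Item.map]

theorem map_injective {f : X → Y} (hf : Function.Injective f) :
    Function.Injective (Item.map f) := by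
  intro e e' h
  cases e <;> cases e' <;> simp only [Item.map, tok.injEq, bond.injEq, reduceCtorEq] at h
  · rw [hf h]
  · rw [Sym2.map.injective hf h]

theorem tok_mem_map_image {f : X → Y} {C : Set (Item X)} {b : Y} :
    tok b ∈ Item.map f '' C ↔ ∃ a, tok a ∈ C ∧ f a = b := by
  constructor
  · rintro ⟨e, he, h⟩
    cases e with
    | tok a => exact ⟨a, he, by simpa using h⟩
    | bond p => simp [Item.map] at h
  · rintro ⟨a, ha, rfl⟩
    exact ⟨_, ha, rfl⟩

theorem bond_mem_map_image {f : X → Y} {C : Set (Item X)} {b c : Y} :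
    bond s(b, c) ∈ Item.map f '' C ↔ ∃ a a', bond s(a, a') ∈ C ∧ f a = b ∧ f a' = c := by
  constructor
  · rintro ⟨e, he, h⟩
    cases e with
    | tok a => simp at h
    | bond p =>
      induction p with
      | h a a' =>
        simp only [map_bond, bond.injEq, Sym2.eq_iff] at h
        rcases h with ⟨h, h'⟩ | ⟨h, h'⟩
        · exact ⟨a, a', he, h, h'⟩
        · exact ⟨a', a, by rwa [Sym2.eq_swap], h', h⟩
  · rintro ⟨a, a', ha, rfl, rfl⟩
    exact ⟨_, ha, rfl⟩

end Item

/-! ### Graphs of tokens and bonds, and their components. -/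

section Graph

variable {X Y : Type*}

/-- The ends of all bonds in `C` are in `C`. -/
def IsGraph (C : Set (Item X)) : Prop := ∀ e ∈ C, ∀ a ∈ e.ends, Item.tok a ∈ C

/-- `a` and `b` are connected by a path of bonds in `C`. -/
def Conn (C : Set (Item X)) : X → X → Prop :=
  Relation.ReflTransGen fun a b => Item.bond s(a, b) ∈ C

/-- The part of `C` that is connected to an element of `B`. -/
def reach (C : Set (Item X)) (B : Set X) : Set (Item X) :=
  {e | e ∈ C ∧ ∃ a ∈ B, ∃ b ∈ e.ends, Conn C a b}

theorem isGraph_iff {C : Set (Item X)} :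
    IsGraph C ↔ ∀ a b, Item.bond s(a, b) ∈ C → Item.tok a ∈ C ∧ Item.tok b ∈ C := by
  constructor
  · exact fun h a b hab => ⟨h _ hab a (by simp), h _ hab b (by simp)⟩
  · intro h e he a ha
    cases e with
    | tok c => rw [Item.mem_ends_tok] at ha; rwa [ha]
    | bond p =>
      induction p with
      | h b c =>
        rw [Item.mem_ends_bond, Sym2.mem_iff] at ha
        rcases ha with rfl | rfl
        · exact (h _ _ he).1
        · exact (h _ _ he).2

theorem IsGraph.map {C : Set (Item X)} (hC : IsGraph C) (f : X → Y) :
    IsGraph (Item.map f '' C) := by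
  rintro _ ⟨e, he, rfl⟩ b hb
  obtain ⟨a, ha, rfl⟩ := Item.mem_ends_map.1 hb
  exact ⟨_, hC e he a ha, rfl⟩

theorem IsGraph.iUnion {ι : Sort*} {C : ι → Set (Item X)} (hC : ∀ i, IsGraph (C i)) :
    IsGraph (⋃ i, C i) := by
  intro e he a ha
  obtain ⟨i, hi⟩ := Set.mem_iUnion.1 he
  exact Set.mem_iUnion.2 ⟨i, hC i e hi a ha⟩

/-- Exchanging a part of a graph for another one with the same elements. -/
theorem IsGraph.switch {C Q R : Set (Item X)} (hC : IsGraph C) (hR : IsGraph R)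
    (hQR : ∀ a, Item.tok a ∈ Q → Item.tok a ∈ R) : IsGraph ((C \ Q) ∪ R) := by
  rintro e (⟨he, -⟩ | he) a ha
  · by_cases h : Item.tok a ∈ Q
    · exact Or.inr (hQR a h)
    · exact Or.inl ⟨hC e he a ha, h⟩
  · exact Or.inr (hR e he a ha)

namespace Conn

variable {C D : Set (Item X)} {a b c : X}

theorem refl (C : Set (Item X)) (a : X) : Conn C a a := Relation.ReflTransGen.refl

theorem tail (h : Conn C a b) (hbc : Item.bond s(b, c) ∈ C) : Conn C a c :=
  Relation.ReflTransGen.tail h hbc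

theorem trans (h : Conn C a b) (h' : Conn C b c) : Conn C a c := Relation.ReflTransGen.trans h h'

theorem symm (h : Conn C a b) : Conn C b a := by
  induction h with
  | refl => exact refl C a
  | @tail b c _ hbc ih => exact Relation.ReflTransGen.head (by rwa [Sym2.eq_swap]) ih

theorem mono (hCD : C ⊆ D) (h : Conn C a b) : Conn D a b :=
  Relation.ReflTransGen.lift id (fun _ _ h => hCD h) _ _ h

theorem tok_mem (hC : IsGraph C) (ha : Item.tok a ∈ C) (h : Conn C a b) : Item.tok b ∈ C := by
  induction h with
  | refl => exact ha
  | tail _ h _ => exact (isGraph_iff.1 hC _ _ h).2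

theorem ends_ends {e : Item X} (he : e ∈ C) (hb : b ∈ e.ends) (hc : c ∈ e.ends) : Conn C b c := by
  cases e with
  | tok d =>
    rw [Item.mem_ends_tok] at hb hc
    rw [hb, hc]
    exact refl C d
  | bond p =>
    induction p with
    | h d d' =>
      simp only [Item.mem_ends_bond, Sym2.mem_iff] at hb hc
      have h1 : Conn C d d' := (refl C d).tail he
      rcases hb with rfl | rfl <;> rcases hc with rfl | rfl
      exacts [refl C _, h1, h1.symm, refl C _]

theorem map (f : X → Y) (h : Conn C a b) : Conn (Item.map f '' C) (f a) (f b) :=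
  Relation.ReflTransGen.lift f (fun _ _ h => ⟨_, h, rfl⟩) _ _ h

/-- Injectivity on the tokens of `C` suffices to lift paths, since in a graph all vertices of a path
that starts at a token are tokens of `C`. -/
theorem of_map {f : X → Y} (hC : IsGraph C) (hf : Set.InjOn f {a | Item.tok a ∈ C})
    (ha : Item.tok a ∈ C) {b : Y} (h : Conn (Item.map f '' C) (f a) b) :
    ∃ c, f c = b ∧ Conn C a c := by
  induction h with
  | refl => exact ⟨a, rfl, refl C a⟩
  | tail _ h ih =>
    obtain ⟨c, rfl, hc⟩ := ih
    obtain ⟨d, d', hd, h1, rfl⟩ := Item.bond_mem_map_image.1 h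
    have : d = c := hf (isGraph_iff.1 hC _ _ hd).1 (hc.tok_mem hC ha) h1
    exact ⟨d', rfl, hc.tail (this ▸ hd)⟩

/-- Paths that start in a union of connected components stay there. -/
theorem of_closed (hD : IsGraph D) (h : Conn C a b) (ha : Item.tok a ∈ D)
    (hCD : ∀ a b, Item.bond s(a, b) ∈ C → Item.tok a ∈ D → Item.bond s(a, b) ∈ D) :
    Conn D a b := by
  induction h with
  | refl => exact refl D a
  | tail _ h ih => exact ih.tail (hCD _ _ h (ih.tok_mem hD ha))

end Conn

/-- In a graph the membership of tokens that `BondStep` demands is automatic, so plain bond paths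
can be used throughout. -/
theorem connected_eq_reach {C : Set (Item X)} (hC : IsGraph C) {a : X} (ha : Item.tok a ∈ C) :
    connected a C = reach C {a} := by
  have key : ∀ {b}, Relation.ReflTransGen (BondStep C) a b ↔ Conn C a b := by
    intro b
    constructor
    · exact fun h => Relation.ReflTransGen.lift id (fun _ _ h => h.1) _ _ h
    · exact fun h =>
        Relation.ReflTransGen.lift id (fun _ _ h => ⟨h, (isGraph_iff.1 hC _ _ h).2⟩) _ _ h
  ext e
  constructor
  · rintro (⟨rfl, -⟩ | ⟨b, c, hb, hbc, rfl | rfl | rfl⟩)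
    · exact ⟨ha, a, rfl, a, rfl, Conn.refl C a⟩
    · exact ⟨hbc.1, a, rfl, b, by simp, key.1 hb⟩
    · exact ⟨(isGraph_iff.1 hC _ _ hbc.1).1, a, rfl, b, rfl, key.1 hb⟩
    · exact ⟨hbc.2, a, rfl, c, rfl, (key.1 hb).tail hbc.1⟩
  · rintro ⟨he, _, rfl, b, hb, hab⟩
    cases e with
    | tok c =>
      obtain rfl := Item.mem_ends_tok.1 hb
      rcases Relation.ReflTransGen.cases_tail hab with rfl | ⟨c, hc, hcb⟩
      · exact Or.inl ⟨rfl, ha⟩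
      · exact Or.inr ⟨c, b, key.2 hc, ⟨hcb, he⟩, Or.inr (Or.inr rfl)⟩
    | bond p =>
      induction p with
      | h c d =>
        have hac : Conn C _ c := hab.trans (Conn.ends_ends he hb (by simp))
        exact Or.inr ⟨c, d, key.2 hac, ⟨he, (isGraph_iff.1 hC _ _ he).2⟩, Or.inl rfl⟩

theorem mem_connected {C : Set (Item X)} (hC : IsGraph C) {a : X} (ha : Item.tok a ∈ C)
    {e : Item X} : e ∈ connected a C ↔ e ∈ C ∧ ∃ b ∈ e.ends, Conn C a b := by
  rw [connected_eq_reach hC ha]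
  simp [reach]

theorem tok_mem_connected {C : Set (Item X)} (hC : IsGraph C) {a : X} (ha : Item.tok a ∈ C)
    {b : X} : Item.tok b ∈ connected a C ↔ Conn C a b := by
  rw [mem_connected hC ha]
  constructor
  · rintro ⟨-, c, rfl, h⟩
    exact h
  · exact fun h => ⟨h.tok_mem hC ha, b, rfl, h⟩

theorem reach_subset (C : Set (Item X)) (B : Set X) : reach C B ⊆ C := fun _ h => h.1

theorem isGraph_reach {C : Set (Item X)} (hC : IsGraph C) (B : Set X) : IsGraph (reach C B) := by
  rintro e ⟨he, a, ha, b, hb, hab⟩ c hc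
  exact ⟨hC e he c hc, a, ha, c, rfl, hab.trans (Conn.ends_ends he hb hc)⟩

theorem map_image_reach {f : X → Y} {C : Set (Item X)} (hC : IsGraph C)
    (hf : Set.InjOn f {a | Item.tok a ∈ C}) {B : Set X} (hB : ∀ a ∈ B, Item.tok a ∈ C) :
    Item.map f '' reach C B = reach (Item.map f '' C) (f '' B) := by
  ext e'
  constructor
  · rintro ⟨e, ⟨he, a, ha, b, hb, hab⟩, rfl⟩
    exact ⟨⟨e, he, rfl⟩, f a, ⟨a, ha, rfl⟩, f b, Item.mem_ends_map.2 ⟨b, hb, rfl⟩, hab.map f⟩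
  · rintro ⟨⟨e, he, rfl⟩, _, ⟨a, ha, rfl⟩, _, hb, hab⟩
    obtain ⟨b, hb', rfl⟩ := Item.mem_ends_map.1 hb
    obtain ⟨c, hc, hac⟩ := Conn.of_map hC hf (hB a ha) hab
    have : c = b := hf (hac.tok_mem hC (hB a ha)) (hC e he b hb') hc
    exact ⟨e, ⟨he, a, ha, b, hb', this ▸ hac⟩, rfl⟩

theorem connected_map {f : X → Y} {C : Set (Item X)} (hC : IsGraph C)
    (hf : Set.InjOn f {a | Item.tok a ∈ C}) {a : X} (ha : Item.tok a ∈ C) :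
    connected (f a) (Item.map f '' C) = Item.map f '' connected a C := by
  rw [connected_eq_reach hC ha, connected_eq_reach (hC.map f) ⟨_, ha, rfl⟩,
    map_image_reach hC hf (by simpa using ha), Set.image_singleton]

/-- Connected components do not change outside of the part in which two graphs differ. -/
theorem connected_congr {C D : Set (Item X)} (hC : IsGraph C) (hD : IsGraph D) {a : X}
    (haC : Item.tok a ∈ C) (haD : Item.tok a ∈ D) {E : Set (Item X)} (hE : IsGraph E)
    (hEC : E ⊆ C) (hED : E ⊆ D) (haE : Item.tok a ∈ E)
    (hCE : ∀ a b, Item.bond s(a, b) ∈ C → Item.tok a ∈ E → Item.bond s(a, b) ∈ E)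
    (hDE : ∀ a b, Item.bond s(a, b) ∈ D → Item.tok a ∈ E → Item.bond s(a, b) ∈ E) :
    connected a C = connected a D := by
  -- Both components are compared with the one in the common part `E`, which no path from `a` can
  -- leave.
  have key : ∀ {F : Set (Item X)}, IsGraph F → Item.tok a ∈ F → E ⊆ F →
      (∀ a b, Item.bond s(a, b) ∈ F → Item.tok a ∈ E → Item.bond s(a, b) ∈ E) →
      connected a F = connected a E := by
    intro F hF haF hEF hFE
    ext e
    rw [mem_connected hF haF, mem_connected hE haE]
    constructor
    · rintro ⟨he, b, hb, hab⟩
      have hab' := hab.of_closed hE haE hFE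
      refine ⟨?_, b, hb, hab'⟩
      have hbE := hab'.tok_mem hE haE
      cases e with
      | tok c => obtain rfl := Item.mem_ends_tok.1 hb; exact hbE
      | bond p =>
        induction p with
        | h c d =>
          have hbc : Conn F b c := Conn.ends_ends he hb (by simp)
          exact hFE c d he ((hbc.of_closed hE hbE hFE).tok_mem hE hbE)
    · rintro ⟨he, b, hb, hab⟩
      exact ⟨hEF he, b, hb, hab.mono hEF⟩
  rw [key hC haC hEC hCE, key hD haD hED hDE]

end Graph

/-! ### Exchange of labels. -/

section Switch

variable {P V X Y : Type*}

/-- `W'` arises from `W` by exchanging the instances that `U` selects by the labels `ℓ` for those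
that it selects by the labels `ℓ'`, and vice versa. Each item of `W` (of `W'`) is connected to
selected elements, all of which belong to the same label of `ℓ` (of `ℓ'`). -/
structure Switch (ℓ ℓ' : P → Set (Item V)) (U : V → X) (W W' : Set (Item X)) : Prop where
  label : ∀ x, IsGraph (ℓ x)
  label' : ∀ x, IsGraph (ℓ' x)
  vars : ∀ u, Item.tok u ∈ ⋃ x, ℓ x ↔ Item.tok u ∈ ⋃ x, ℓ' x
  graph : IsGraph W
  graph' : IsGraph W'
  eq' : W' = (W \ Item.map U '' ⋃ x, ℓ x) ∪ Item.map U '' ⋃ x, ℓ' x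
  eq : W = (W' \ Item.map U '' ⋃ x, ℓ' x) ∪ Item.map U '' ⋃ x, ℓ x
  hom : ∀ x y u v, Item.tok u ∈ ℓ x → Item.tok v ∈ ℓ y → Conn W (U u) (U v) → x = y
  hom' : ∀ x y u v, Item.tok u ∈ ℓ' x → Item.tok v ∈ ℓ' y → Conn W' (U u) (U v) → x = y
  cover : ∀ e ∈ W, ∃ x, e ∈ reach W (U '' {u | Item.tok u ∈ ℓ x})
  cover' : ∀ e ∈ W', ∃ x, e ∈ reach W' (U '' {u | Item.tok u ∈ ℓ' x})

theorem tok_mem_image_iUnion {ℓ : P → Set (Item V)} {U : V → X} {a : X} :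
    Item.tok a ∈ Item.map U '' (⋃ x, ℓ x) ↔ ∃ u x, Item.tok u ∈ ℓ x ∧ U u = a := by
  rw [Item.tok_mem_map_image]
  simp only [Set.mem_iUnion]
  tauto

namespace Switch

variable {ℓ ℓ' : P → Set (Item V)} {U : V → X} {W W' : Set (Item X)}

theorem symm (h : Switch ℓ ℓ' U W W') : Switch ℓ' ℓ U W' W :=
  ⟨h.label', h.label, fun u => (h.vars u).symm, h.graph', h.graph, h.eq, h.eq', h.hom', h.hom,
    h.cover', h.cover⟩

theorem pre_subset (h : Switch ℓ ℓ' U W W') : Item.map U '' (⋃ x, ℓ x) ⊆ W := by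
  rw [h.eq]
  exact Set.subset_union_right

theorem var_mem (h : Switch ℓ ℓ' U W W') {u : V} {x : P} (hu : Item.tok u ∈ ℓ x) :
    Item.tok (U u) ∈ W :=
  h.pre_subset ⟨_, Set.mem_iUnion.2 ⟨x, hu⟩, rfl⟩

theorem tok_pre_iff (h : Switch ℓ ℓ' U W W') (a : X) :
    Item.tok a ∈ Item.map U '' (⋃ x, ℓ x) ↔ Item.tok a ∈ Item.map U '' (⋃ x, ℓ' x) := by
  simp only [Item.tok_mem_map_image, h.vars]

theorem tok_mem_iff (h : Switch ℓ ℓ' U W W') (a : X) : Item.tok a ∈ W ↔ Item.tok a ∈ W' := by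
  have key : ∀ {m m' : P → Set (Item V)} {Z Z' : Set (Item X)}, Switch m m' U Z Z' →
      Item.tok a ∈ Z → Item.tok a ∈ Z' := by
    intro m m' Z Z' hs ha
    rw [hs.eq']
    by_cases hQ : Item.tok a ∈ Item.map U '' ⋃ x, m x
    · exact Or.inr ((hs.tok_pre_iff a).1 hQ)
    · exact Or.inl ⟨ha, hQ⟩
  exact ⟨key h, key h.symm⟩

/-- Reversal exchanges labels on tokens whose memories have already been extended, so the exchange
has to be transported along the extension. -/
theorem map (h : Switch ℓ ℓ' U W W') {g : X → Y} (hg : Function.Injective g) :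
    Switch ℓ ℓ' (g ∘ U) (Item.map g '' W) (Item.map g '' W') := by
  have himg : ∀ E : Set (Item V), Item.map (g ∘ U) '' E = Item.map g '' (Item.map U '' E) := by
    intro E
    rw [Set.image_image]
    simp only [Item.map_map]
  have hinj := Item.map_injective hg
  have hhom : ∀ {m : P → Set (Item V)} {Z : Set (Item X)}, IsGraph Z →
      (∀ x u, Item.tok u ∈ m x → Item.tok (U u) ∈ Z) →
      (∀ x y u v, Item.tok u ∈ m x → Item.tok v ∈ m y → Conn Z (U u) (U v) → x = y) →
      ∀ x y u v, Item.tok u ∈ m x → Item.tok v ∈ m y →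
        Conn (Item.map g '' Z) ((g ∘ U) u) ((g ∘ U) v) → x = y := by
    intro m Z hZ hm hh x y u v hu hv huv
    obtain ⟨c, hc, hac⟩ := Conn.of_map hZ hg.injOn (hm x u hu) huv
    exact hh x y u v hu hv (hg hc ▸ hac)
  have hcov : ∀ {m : P → Set (Item V)} {Z : Set (Item X)}, IsGraph Z →
      (∀ x u, Item.tok u ∈ m x → Item.tok (U u) ∈ Z) →
      (∀ e ∈ Z, ∃ x, e ∈ reach Z (U '' {u | Item.tok u ∈ m x})) →
      ∀ e ∈ Item.map g '' Z, ∃ x, e ∈ reach (Item.map g '' Z) (g ∘ U '' {u | Item.tok u ∈ m x}) := by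
    rintro m Z hZ hm hh _ ⟨e, he, rfl⟩
    obtain ⟨x, hx⟩ := hh e he
    refine ⟨x, ?_⟩
    rw [Set.image_comp, ← map_image_reach hZ hg.injOn]
    · exact ⟨e, hx, rfl⟩
    · rintro _ ⟨u, hu, rfl⟩
      exact hm x u hu
  refine ⟨h.label, h.label', h.vars, h.graph.map g, h.graph'.map g, ?_, ?_,
    hhom h.graph (fun _ _ => h.var_mem) h.hom, hhom h.graph' (fun _ _ => h.symm.var_mem) h.hom',
    hcov h.graph (fun _ _ => h.var_mem) h.cover, hcov h.graph' (fun _ _ => h.symm.var_mem) h.cover'⟩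
  · rw [himg, himg, ← Set.image_sdiff hinj, ← Set.image_union, ← h.eq']
  · rw [himg, himg, ← Set.image_sdiff hinj, ← Set.image_union, ← h.eq]

/-- The parts of `W` that belong to different labels are disjoint. -/
theorem reach_unique (h : Switch ℓ ℓ' U W W') {x y : P} {a : X}
    (hx : Item.tok a ∈ reach W (U '' {u | Item.tok u ∈ ℓ x}))
    (hy : Item.tok a ∈ reach W (U '' {u | Item.tok u ∈ ℓ y})) : x = y := by
  obtain ⟨-, _, ⟨u, hu, rfl⟩, b, rfl, hub⟩ := hx
  obtain ⟨-, _, ⟨v, hv, rfl⟩, b, rfl, hvb⟩ := hy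
  exact h.hom x y u v hu hv (hub.trans hvb.symm)

end Switch

variable {m : P → Set (Item X)} {W Q : Set (Item X)} {ℓ : P → Set (Item V)} {U : V → X}

/-- If the components that result from an exchange of labels within the single places do not
connect different labels, then each path in the union of the places can be replaced by one within a
single place. -/
theorem exists_local_conn (huniq : ∀ x y a, Item.tok a ∈ m x → Item.tok a ∈ m y → x = y)
    (hm : ∀ x, IsGraph (m x)) (hWm : W ⊆ ⋃ x, m x) (hℓ : ∀ x, IsGraph (ℓ x))
    (hℓW : ∀ x u, Item.tok u ∈ ℓ x → Item.tok (U u) ∈ W)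
    (hom : ∀ x y z u v, Item.tok u ∈ ℓ x → Item.tok v ∈ ℓ y → Item.tok (U u) ∈ m z →
      Conn ((m z \ Q) ∪ Item.map U '' ⋃ x, ℓ x) (U u) (U v) → x = y)
    {u : V} {x : P} (hu : Item.tok u ∈ ℓ x) {b : X}
    (h : Conn ((W \ Q) ∪ Item.map U '' ⋃ x, ℓ x) (U u) b) :
    ∃ w z, Item.tok w ∈ ℓ x ∧ Item.tok (U w) ∈ m z ∧ Item.tok b ∈ m z ∧
      Conn ((m z \ Q) ∪ Item.map U '' ⋃ x, ℓ x) (U w) b := by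
  induction h with
  | refl =>
    obtain ⟨z, hz⟩ := Set.mem_iUnion.1 (hWm (hℓW x u hu))
    exact ⟨u, z, hu, hz, hz, Conn.refl _ _⟩
  | tail _ hbc ih =>
    obtain ⟨w, z, hw, hwz, hbz, hwb⟩ := ih
    rcases hbc with ⟨hbc, hQ⟩ | hbc
    · obtain ⟨z', hz'⟩ := Set.mem_iUnion.1 (hWm hbc)
      have hends := isGraph_iff.1 (hm z') _ _ hz'
      obtain rfl := huniq z z' _ hbz hends.1
      exact ⟨w, z, hw, hwz, hends.2, hwb.tail (Or.inl ⟨hz', hQ⟩)⟩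
    -- An inserted bond may lead into another place, but both its ends are variables of one label.
    -- By `hom` this is the label `x`, so the path can be restarted at the far end.
    · obtain ⟨v, v', hvv, rfl, rfl⟩ := Item.bond_mem_map_image.1 hbc
      obtain ⟨y, hy⟩ := Set.mem_iUnion.1 hvv
      have hends := isGraph_iff.1 (hℓ y) _ _ hy
      obtain rfl := hom x y z w v hw hends.1 hwz hwb
      obtain ⟨z', hz'⟩ := Set.mem_iUnion.1 (hWm (hℓW x v' hends.2))
      exact ⟨v', z', hends.2, hz', hz', Conn.refl _ _⟩

/-- The components that result from an exchange of labels within the single places make up those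
that result from the exchange of labels in the union of the places. -/
theorem setOf_local_connected_eq_reach
    (huniq : ∀ x y a, Item.tok a ∈ m x → Item.tok a ∈ m y → x = y)
    (hm : ∀ x, IsGraph (m x)) (hW : IsGraph W) (hWm : W ⊆ ⋃ x, m x)
    (hcl : ∀ x a b, Item.bond s(a, b) ∈ m x → Item.tok a ∈ W → Item.bond s(a, b) ∈ W)
    (hℓ : ∀ x, IsGraph (ℓ x))
    (hℓW : ∀ x u, Item.tok u ∈ ℓ x → Item.tok (U u) ∈ W)
    (hQ : ∀ a, Item.tok a ∈ Q → Item.tok a ∈ Item.map U '' ⋃ x, ℓ x)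
    (hom : ∀ x y z u v, Item.tok u ∈ ℓ x → Item.tok v ∈ ℓ y → Item.tok (U u) ∈ m z →
      Conn ((m z \ Q) ∪ Item.map U '' ⋃ x, ℓ x) (U u) (U v) → x = y) (x : P) :
    {e | ∃ u y, Item.tok u ∈ ℓ x ∧ Item.tok (U u) ∈ m y ∧
      e ∈ connected (U u) ((m y \ Q) ∪ Item.map U '' ⋃ x, ℓ x)} =
    reach ((W \ Q) ∪ Item.map U '' ⋃ x, ℓ x) (U '' {u | Item.tok u ∈ ℓ x}) := by
  have hR : IsGraph (Item.map U '' ⋃ x, ℓ x) := (IsGraph.iUnion hℓ).map U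
  have hWs : IsGraph ((W \ Q) ∪ Item.map U '' ⋃ x, ℓ x) := hW.switch hR hQ
  have hms : ∀ y, IsGraph ((m y \ Q) ∪ Item.map U '' ⋃ x, ℓ x) := fun y => (hm y).switch hR hQ
  have hvar : ∀ {u x}, Item.tok u ∈ ℓ x → Item.tok (U u) ∈ Item.map U '' ⋃ x, ℓ x :=
    fun {u x} hu => ⟨_, Set.mem_iUnion.2 ⟨x, hu⟩, rfl⟩
  have hRW : ∀ a, Item.tok a ∈ (W \ Q) ∪ Item.map U '' ⋃ x, ℓ x → Item.tok a ∈ W := by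
    rintro a (h | h)
    · exact h.1
    · obtain ⟨u, x, hu, rfl⟩ := tok_mem_image_iUnion.1 h
      exact hℓW x u hu
  ext e
  constructor
  · rintro ⟨u, y, hu, huy, he⟩
    rw [mem_connected (hms y) (Or.inr (hvar hu))] at he
    obtain ⟨he, b, hb, hub⟩ := he
    have hcl' : ∀ a b, Item.bond s(a, b) ∈ (m y \ Q) ∪ Item.map U '' ⋃ x, ℓ x →
        Item.tok a ∈ (W \ Q) ∪ Item.map U '' ⋃ x, ℓ x →
        Item.bond s(a, b) ∈ (W \ Q) ∪ Item.map U '' ⋃ x, ℓ x := by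
      rintro a b (h | h) ha
      · exact Or.inl ⟨hcl y a b h.1 (hRW a ha), h.2⟩
      · exact Or.inr h
    have hub' := hub.of_closed hWs (Or.inr (hvar hu)) hcl'
    have hbW := hub'.tok_mem hWs (Or.inr (hvar hu))
    refine ⟨?_, U u, ⟨u, hu, rfl⟩, b, hb, hub'⟩
    cases e with
    | tok c => obtain rfl := Item.mem_ends_tok.1 hb; exact hbW
    | bond p =>
      induction p with
      | h c d =>
        have hbc : Conn _ b c := Conn.ends_ends he hb (by simp)
        exact hcl' c d he ((hbc.of_closed hWs hbW hcl').tok_mem hWs hbW)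
  · rintro ⟨he, _, ⟨u, hu, rfl⟩, b, hb, hub⟩
    obtain ⟨w, z, hw, hwz, hbz, hwb⟩ := exists_local_conn huniq hm hWm hℓ hℓW hom hu hub
    rcases he with ⟨he, hQe⟩ | he
    · obtain ⟨z', hz'⟩ := Set.mem_iUnion.1 (hWm he)
      obtain rfl := huniq z z' b hbz (hm z' e hz' b hb)
      exact ⟨w, z, hw, hwz, (mem_connected (hms z) (Or.inr (hvar hw))).2
        ⟨Or.inl ⟨hz', hQe⟩, b, hb, hwb⟩⟩
    · have he' := he
      obtain ⟨e, he₀, rfl⟩ := he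
      obtain ⟨v, hv, rfl⟩ := Item.mem_ends_map.1 hb
      obtain ⟨y, hy⟩ := Set.mem_iUnion.1 he₀
      have hvy := hℓ y e hy v hv
      obtain rfl := hom x y z w v hw hvy hwz hwb
      exact ⟨v, z, hvy, hbz, (mem_connected (hms z) (Or.inr (hvar hvy))).2
        ⟨Or.inr he', U v, hb, Conn.refl _ _⟩⟩

end Switch

/-! ### Memories and their keys. -/

namespace TokenInst

variable {A V : Type*}

/-- The keys of the memories of a token instance. -/
def keys (a : TokenInst A V) : Set ℕ := {l | ∃ b u, (step b l u).EvolvesTo a}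

theorem evolvesTo_init {a : TokenInst A V} {b : A} {i : ℕ} :
    a.EvolvesTo (init b i) ↔ a = init b i := by
  constructor
  · rintro ⟨⟩
    rfl
  · rintro rfl
    exact .refl _

theorem evolvesTo_step {a b : TokenInst A V} {k : ℕ} {u : Option V} :
    a.EvolvesTo (step b k u) ↔ a = step b k u ∨ a.EvolvesTo b := by
  constructor
  · intro h
    cases h with
    | refl => exact Or.inl rfl
    | step _ _ h => exact Or.inr h
  · rintro (rfl | h)
    · exact .refl _
    · exact .step k u h

theorem mem_keys_of_evolvesTo {a b : TokenInst A V} {k : ℕ} {u : Option V}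
    (h : (step b k u).EvolvesTo a) : k ∈ a.keys := ⟨b, u, h⟩

@[simp] theorem keys_init (a : A) (i : ℕ) : (init a i : TokenInst A V).keys = ∅ := by
  ext l
  simp [keys, evolvesTo_init]

@[simp] theorem mem_keys_step {a : TokenInst A V} {k l : ℕ} {u : Option V} :
    l ∈ (step a k u).keys ↔ l = k ∨ l ∈ a.keys := by
  simp only [keys, evolvesTo_step, Set.mem_ofPred_eq, step.injEq]
  constructor
  · rintro ⟨b, v, ⟨-, h, -⟩ | h⟩
    exacts [Or.inl h, Or.inr ⟨b, v, h⟩]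
  · rintro (rfl | ⟨b, v, h⟩)
    exacts [⟨a, u, Or.inl ⟨rfl, rfl, rfl⟩⟩, ⟨b, v, Or.inr h⟩]

theorem origin_eq_self {a : TokenInst A V} (h : a.keys = ∅) : a.origin = a := by
  cases a with
  | init => rfl
  | step a k u =>
    have hk : k ∈ (step a k u).keys := by simp
    simp [h] at hk

theorem truncate_eq_self {a : TokenInst A V} {l : ℕ} (h : ∀ k ∈ a.keys, k ≤ l) :
    a.truncate l = a := by
  cases a with
  | init => rfl
  | step a k u => simp [truncate, h k (by simp)]

theorem forget_eq_self {a : TokenInst A V} {k : ℕ} (h : k ∉ a.keys) : a.forget k = a := by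
  induction a with
  | init => rfl
  | step a l u ih =>
    simp only [mem_keys_step, not_or] at h
    simp [forget, Ne.symm h.1, ih h.2]

theorem forget_step {a : TokenInst A V} {k : ℕ} (h : k ∉ a.keys) (u : Option V) :
    (step a k u).forget k = a := by
  simp [forget, forget_eq_self h]

end TokenInst

theorem bond_mem_reach {X : Type*} {C : Set (Item X)} {B : Set X} {a b : X}
    (h : Item.bond s(a, b) ∈ C) (ha : Item.tok a ∈ reach C B) : Item.bond s(a, b) ∈ reach C B := by
  obtain ⟨-, c, hc, _, rfl, hca⟩ := ha
  exact ⟨h, c, hc, _, by simp, hca⟩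

/-! ### Firings and the invariant of forward execution. -/

namespace MRPN

variable {P T A V : Type*} (N : MRPN P T A V)

/-- The local effect of an occurrence of `t`: the components `W` of the tokens that take part in it
become `W'`, before their memories are extended. -/
structure Firing (t : T) (U : V → TokenInst A V) (W W' : Set (Item (TokenInst A V))) : Prop where
  inj : Set.InjOn U {u | Item.tok u ∈ N.guard t}
  switch : Switch (fun x => N.arcIn x t) (N.arcOut t) U W W'

/-- The part of `W` that `t` takes from place `x`. -/
def inPart (t : T) (U : V → TokenInst A V) (W : Set (Item (TokenInst A V))) (x : P) :
    Set (Item (TokenInst A V)) :=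
  reach W (U '' {u | Item.tok u ∈ N.arcIn x t})

/-- The part of `W'` that `t` puts into place `x`, before the extension of memories. -/
def outPart (t : T) (U : V → TokenInst A V) (W' : Set (Item (TokenInst A V))) (x : P) :
    Set (Item (TokenInst A V)) :=
  reach W' (U '' {u | Item.tok u ∈ N.arcOut t x})

/-- The extension of the memory of a token in an occurrence of `t` with key `k`. -/
noncomputable def extend (t : T) (k : ℕ) (U : V → TokenInst A V) (a : TokenInst A V) :
    TokenInst A V :=
  TokenInst.step a k (N.varOf t U a)

/-- The part of place `x` that an occurrence of `t` has put there. -/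
def newPart (t : T) (k : ℕ) (U : V → TokenInst A V) (W' : Set (Item (TokenInst A V))) (x : P) :
    Set (Item (TokenInst A V)) :=
  Item.map (N.extend t k U) '' N.outPart t U W' x

/-- The state after a firing. -/
def fire (s : State P T A V) (t : T) (k : ℕ) (U : V → TokenInst A V)
    (W W' : Set (Item (TokenInst A V))) : State P T A V where
  M x := (s.M x \ N.inPart t U W x) ∪ N.newPart t k U W' x
  H t' := {l | l ∈ s.H t' ∨ (t' = t ∧ l = k)}

/-- The state before a firing. -/
def unfire (s : State P T A V) (t : T) (k : ℕ) (U : V → TokenInst A V)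
    (W W' : Set (Item (TokenInst A V))) : State P T A V where
  M x := (s.M x \ N.newPart t k U W' x) ∪ N.inPart t U W x
  H := revHistory s.H t k

/-- `W` consists of whole components in the places from which `t` takes them. -/
def Fits (M : Marking P A V) (t : T) (U : V → TokenInst A V) (W : Set (Item (TokenInst A V))) :
    Prop :=
  (∀ x, N.inPart t U W x ⊆ M x) ∧
    ∀ x a b, Item.bond s(a, b) ∈ M x → Item.tok a ∈ W → Item.bond s(a, b) ∈ W

/-- The states that are reached by forward execution with arbitrary increasing keys. -/
inductive Gapped (M₀ : Marking P A V) : State P T A V → Prop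
  | init : Gapped M₀ (initialState M₀)
  | fire {s : State P T A V} {t : T} {k : ℕ} {U : V → TokenInst A V}
      {W W' : Set (Item (TokenInst A V))} : Gapped M₀ s → (∀ t' l, l ∈ s.H t' → l < k) →
      N.Firing t U W W' → N.Fits s.M t U W → Gapped M₀ (N.fire s t k U W W')

/-- The properties of the reachable states: tokens are in one place, bonds in the place of their
tokens, memories refer to the history, keys are unique, and the last occurrence that has manipulated
a component has changed each of its tokens and has put it into its place. -/
structure Regular (M₀ : Marking P A V) (s : State P T A V) : Prop where
  graph : ∀ x, IsGraph (s.M x)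
  uniq : ∀ x y a, Item.tok a ∈ s.M x → Item.tok a ∈ s.M y → x = y
  keys : ∀ x a, Item.tok a ∈ s.M x → ∀ l ∈ a.keys, ∃ t, l ∈ s.H t
  hist : ∀ t t' l, l ∈ s.H t → l ∈ s.H t' → t = t'
  comp : ∀ x a, Item.tok a ∈ s.M x →
    (connected a (s.M x) ⊆ M₀ x ∧ ∀ b, Item.tok b ∈ connected a (s.M x) → b.keys = ∅) ∨
    ∃ t l, l ∈ s.H t ∧ (∃ b u, Item.tok (TokenInst.step b l (some u)) ∈ connected a (s.M x)) ∧
      ∀ b, Item.tok b ∈ connected a (s.M x) → (∀ l' ∈ b.keys, l' ≤ l) ∧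
        ∀ c u, (TokenInst.step c l (some u)).EvolvesTo b → Item.tok u ∈ N.arcOut t x

variable {N} {M₀ : Marking P A V} {s : State P T A V} {t : T} {k : ℕ} {U : V → TokenInst A V}
  {W W' : Set (Item (TokenInst A V))}

theorem extend_injective : Function.Injective (N.extend t k U) :=
  fun _ _ h => (TokenInst.step.inj h).1

theorem mem_keys_extend (a : TokenInst A V) : k ∈ (N.extend t k U a).keys := by
  simp [extend]

theorem varOf_eq_some {a : TokenInst A V} {u : V} (h : N.varOf t U a = some u) :
    Item.tok u ∈ N.guard t ∧ U u = a := by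
  unfold varOf at h
  split_ifs at h with h'
  rw [← Option.some.inj h]
  exact h'.choose_spec

namespace Firing

theorem extend_apply (hf : N.Firing t U W W') (k : ℕ) {u : V} (hu : Item.tok u ∈ N.guard t) :
    N.extend t k U (U u) = TokenInst.step (U u) k (some u) := by
  have h : ∃ v, Item.tok v ∈ N.guard t ∧ U v = U u := ⟨u, hu, rfl⟩
  rw [extend, varOf, dif_pos h, hf.inj h.choose_spec.1 hu h.choose_spec.2]

theorem guard_iff_effects (hf : N.Firing t U W W') (u : V) :
    Item.tok u ∈ N.guard t ↔ Item.tok u ∈ N.effects t := hf.switch.vars u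

theorem exists_inPart (hf : N.Firing t U W W') {e : Item (TokenInst A V)} (he : e ∈ W) :
    ∃ x, e ∈ N.inPart t U W x := hf.switch.cover e he

theorem exists_outPart (hf : N.Firing t U W W') {e : Item (TokenInst A V)} (he : e ∈ W') :
    ∃ x, e ∈ N.outPart t U W' x := hf.switch.cover' e he

theorem isGraph_newPart (hf : N.Firing t U W W') (k : ℕ) (x : P) : IsGraph (N.newPart t k U W' x) :=
  (isGraph_reach hf.switch.graph' _).map _

theorem isGraph_inPart (hf : N.Firing t U W W') (x : P) : IsGraph (N.inPart t U W x) :=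
  isGraph_reach hf.switch.graph _

theorem tok_mem_of_newPart (hf : N.Firing t U W W') {x : P} {a : TokenInst A V}
    (ha : Item.tok a ∈ N.newPart t k U W' x) :
    ∃ b, Item.tok b ∈ N.outPart t U W' x ∧ Item.tok b ∈ W ∧ N.extend t k U b = a := by
  obtain ⟨b, hb, rfl⟩ := Item.tok_mem_map_image.1 ha
  exact ⟨b, hb, (hf.switch.tok_mem_iff b).2 (reach_subset _ _ hb), rfl⟩

theorem mem_keys_of_newPart (hf : N.Firing t U W W') {x : P} {e : Item (TokenInst A V)}
    (he : e ∈ N.newPart t k U W' x) {a : TokenInst A V} (ha : a ∈ e.ends) : k ∈ a.keys := by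
  obtain ⟨b, -, rfl⟩ := Item.tok_mem_map_image.1 (hf.isGraph_newPart k x e he a ha)
  exact mem_keys_extend b

end Firing

namespace Fits

theorem exists_mem (hfit : N.Fits s.M t U W) (hf : N.Firing t U W W') {e : Item (TokenInst A V)}
    (he : e ∈ W) : ∃ x, e ∈ N.inPart t U W x ∧ e ∈ s.M x := by
  obtain ⟨x, hx⟩ := hf.exists_inPart he
  exact ⟨x, hx, hfit.1 x hx⟩

/-- What a firing does not take from a place is not connected to what it takes. -/
theorem not_mem_of_mem_diff (hfit : N.Fits s.M t U W) (hf : N.Firing t U W W')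
    (hs : N.Regular M₀ s) {x : P} {e : Item (TokenInst A V)} (he : e ∈ s.M x \ N.inPart t U W x)
    {a : TokenInst A V} (ha : a ∈ e.ends) : Item.tok a ∉ W := by
  intro haW
  have heW : e ∈ W := by
    cases e with
    | tok b => obtain rfl := Item.mem_ends_tok.1 ha; exact haW
    | bond p =>
      obtain ⟨b, rfl⟩ := Sym2.mem_iff_exists.1 (Item.mem_ends_bond.1 ha)
      exact hfit.2 x a b he.1 haW
  obtain ⟨y, hy, hyM⟩ := hfit.exists_mem hf heW
  obtain rfl := hs.uniq x y a (hs.graph x e he.1 a ha) (hs.graph y e hyM a ha)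
  exact he.2 hy

end Fits

/-- The key `k` is fresh, hence carried by all new tokens and by no old one. New and old components
therefore never mix: the old ones keep their justification, and the new ones have `(t, k)` as last
occurrence. -/
theorem Regular.fire (hs : N.Regular M₀ s) (hk : ∀ t' l, l ∈ s.H t' → l < k)
    (hf : N.Firing t U W W') (hfit : N.Fits s.M t U W) : N.Regular M₀ (N.fire s t k U W W') := by
  have hkey : ∀ {x a}, Item.tok a ∈ s.M x → k ∉ a.keys := by
    intro x a ha hka
    obtain ⟨t', ht'⟩ := hs.keys x a ha k hka
    exact lt_irrefl k (hk t' k ht')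
  have hkeyW : ∀ {a}, Item.tok a ∈ W → ∀ l ∈ a.keys, ∃ t, l ∈ s.H t := by
    intro a ha
    obtain ⟨y, -, hy⟩ := hfit.exists_mem hf ha
    exact hs.keys y a hy
  have hnew : ∀ {x a}, Item.tok a ∈ N.newPart t k U W' x → k ∈ a.keys :=
    fun ha => hf.mem_keys_of_newPart ha rfl
  have hdiff : ∀ x, IsGraph (s.M x \ N.inPart t U W x) := by
    intro x e he a ha
    refine ⟨hs.graph x e he.1 a ha, fun h => ?_⟩
    exact hfit.not_mem_of_mem_diff hf hs he ha (reach_subset _ _ h)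
  have hgraph : ∀ x, IsGraph ((N.fire s t k U W W').M x) := by
    rintro x e (he | he) a ha
    · exact Or.inl (hdiff x e he a ha)
    · exact Or.inr (hf.isGraph_newPart k x e he a ha)
  refine ⟨hgraph, ?_, ?_, ?_, ?_⟩
  · rintro x y a (ha | ha) (ha' | ha')
    · exact hs.uniq x y a ha.1 ha'.1
    · exact (hkey ha.1 (hnew ha')).elim
    · exact (hkey ha'.1 (hnew ha)).elim
    · obtain ⟨b, hb, -, rfl⟩ := hf.tok_mem_of_newPart ha
      obtain ⟨c, hc, -, h⟩ := hf.tok_mem_of_newPart ha'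
      obtain rfl := extend_injective h
      exact hf.switch.symm.reach_unique hb hc
  · rintro x a (ha | ha) l hl
    · obtain ⟨t', ht'⟩ := hs.keys x a ha.1 l hl
      exact ⟨t', Or.inl ht'⟩
    · obtain ⟨b, -, hb, rfl⟩ := hf.tok_mem_of_newPart ha
      rcases TokenInst.mem_keys_step.1 hl with rfl | hl
      · exact ⟨t, Or.inr ⟨rfl, rfl⟩⟩
      · obtain ⟨t', ht'⟩ := hkeyW hb l hl
        exact ⟨t', Or.inl ht'⟩
  · rintro t₁ t₂ l (h | ⟨rfl, rfl⟩) (h' | ⟨rfl, h'⟩)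
    · exact hs.hist t₁ t₂ l h h'
    · exact (lt_irrefl k (hk t₁ k (h' ▸ h))).elim
    · exact (lt_irrefl _ (hk t₂ _ h')).elim
    · rfl
  · rintro x a (ha | ha)
    · have hcon : connected a ((N.fire s t k U W W').M x) = connected a (s.M x) := by
        refine connected_congr (hgraph x) (hs.graph x) (Or.inl ha) ha.1 (hdiff x)
          Set.subset_union_left Set.sdiff_subset ha ?_ ?_
        · rintro b c (hbc | hbc) hb
          · exact hbc
          · exact (hkey hb.1 (hf.mem_keys_of_newPart hbc (by simp))).elim
        · intro b c hbc hb
          exact ⟨hbc, fun h => hb.2 (hf.isGraph_inPart x _ h b (by simp))⟩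
      rw [hcon]
      rcases hs.comp x a ha.1 with h | ⟨t', l, hl, h⟩
      · exact Or.inl h
      · exact Or.inr ⟨t', l, Or.inl hl, h⟩
    · have hcon : connected a ((N.fire s t k U W W').M x) = connected a (N.newPart t k U W' x) := by
        refine connected_congr (hgraph x) (hf.isGraph_newPart k x) (Or.inr ha) ha
          (hf.isGraph_newPart k x) Set.subset_union_right subset_rfl ha ?_ fun _ _ h _ => h
        rintro b c (hbc | hbc) hb
        · exact (hkey (hs.graph x _ hbc.1 b (by simp)) (hnew hb)).elim
        · exact hbc
      rw [hcon]
      -- Each new component contains a selected token, because `outPart` consists of what is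
      -- connected to one. Its variables all lie on the arc to `x`, because parts for different
      -- places are disjoint.
      refine Or.inr ⟨t, k, Or.inr ⟨rfl, rfl⟩, ?_, ?_⟩
      · obtain ⟨b, hb, -, rfl⟩ := hf.tok_mem_of_newPart ha
        obtain ⟨-, _, ⟨u, hu, rfl⟩, _, rfl, hub⟩ := id hb
        refine ⟨U u, u, ?_⟩
        have hug : Item.tok u ∈ N.guard t :=
          (hf.guard_iff_effects u).2 (Set.mem_iUnion.2 ⟨x, hu⟩)
        rw [← hf.extend_apply k hug, tok_mem_connected (hf.isGraph_newPart k x) ha]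
        refine Conn.map _ (hub.symm.of_closed (isGraph_reach hf.switch.graph' _) hb ?_)
        exact fun a b => bond_mem_reach
      · intro c hc
        have hc' := ((mem_connected (hf.isGraph_newPart k x) ha).1 hc).1
        obtain ⟨b, hbx, hb, rfl⟩ := hf.tok_mem_of_newPart hc'
        constructor
        · intro l hl
          rcases TokenInst.mem_keys_step.1 hl with rfl | hl
          · exact le_rfl
          · obtain ⟨t', ht'⟩ := hkeyW hb l hl
            exact (hk t' l ht').le
        · intro d u hd
          rcases TokenInst.evolvesTo_step.1 hd with h | h
          · obtain ⟨rfl, -, h⟩ := TokenInst.step.inj h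
            obtain ⟨hu, rfl⟩ := varOf_eq_some h.symm
            obtain ⟨y, hy⟩ := Set.mem_iUnion.1 ((hf.guard_iff_effects u).1 hu)
            have huy : Item.tok (U u) ∈ N.outPart t U W' y :=
              ⟨reach_subset _ _ hbx, U u, ⟨u, hy, rfl⟩, U u, rfl, Conn.refl _ _⟩
            obtain rfl := hf.switch.symm.reach_unique hbx huy
            exact hy
          · obtain ⟨t', ht'⟩ := hkeyW hb k (TokenInst.mem_keys_of_evolvesTo h)
            exact (lt_irrefl k (hk t' k ht')).elim

theorem regular_initialState (hM₀ : N.IsInitialMarking M₀) :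
    N.Regular M₀ (initialState M₀ : State P T A V) := by
  have hgraph : ∀ x, IsGraph (M₀ x) := fun x =>
    isGraph_iff.2 fun a b h => ⟨(hM₀.2.2 x a b h).1, (hM₀.2.2 x a b h).2.1⟩
  have hkeys : ∀ x a, Item.tok a ∈ M₀ x → a.keys = ∅ := by
    intro x a ha
    obtain ⟨b, i, rfl⟩ := hM₀.1 x a ha
    exact TokenInst.keys_init b i
  refine ⟨hgraph, hM₀.2.1, ?_, fun _ _ _ h => h.elim, fun x a ha => Or.inl ⟨?_, ?_⟩⟩
  · intro x a ha l hl
    rw [hkeys x a ha] at hl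
    exact hl.elim
  · exact fun e he => ((mem_connected (hgraph x) ha).1 he).1
  · exact fun b hb => hkeys x b ((mem_connected (hgraph x) ha).1 hb).1

theorem Gapped.regular (hM₀ : N.IsInitialMarking M₀) (h : N.Gapped M₀ s) : N.Regular M₀ s := by
  induction h with
  | init => exact regular_initialState hM₀
  | fire _ hk hf hfit ih => exact ih.fire hk hf hfit

end MRPN

namespace MRPN

variable {P T A V : Type*} {N : MRPN P T A V} {M₀ : Marking P A V} {s s' : State P T A V} {t : T}
  {k : ℕ} {U : V → TokenInst A V} {W W' : Set (Item (TokenInst A V))}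

/-! ### Undoing an occurrence that has no causal successors -/

variable (N M₀ s t k U W W') in
/-- The occurrence `(t, k)` has no causal successors in `s`, and the state that results from undoing
it is reached without it. -/
structure Undoable : Prop where
  firing : N.Firing t U W W'
  new_subset : ∀ x, N.newPart t k U W' x ⊆ s.M x
  new_closed : ∀ x a b, Item.bond s(a, b) ∈ s.M x → Item.tok a ∈ N.newPart t k U W' x →
    Item.bond s(a, b) ∈ N.newPart t k U W' x
  old_disjoint : ∀ x, ∀ e ∈ s.M x, e ∉ N.newPart t k U W' x → ∀ a ∈ e.ends, Item.tok a ∉ W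
  keys : ∀ x a, Item.tok a ∈ s.M x → k ∈ a.keys → Item.tok a ∈ N.newPart t k U W' x
  gapped : N.Gapped M₀ (N.unfire s t k U W W')

/-- Removing the new part is exact: its items carry `k` at every end, and nothing in `s` does. -/
theorem unfire_fire (hs : N.Regular M₀ s) (hk : ∀ t' l, l ∈ s.H t' → l < k)
    (hf : N.Firing t U W W') (hfit : N.Fits s.M t U W)
    (hkey : ∀ x a, Item.tok a ∈ s.M x → k ∉ a.keys) :
    N.unfire (N.fire s t k U W W') t k U W W' = s := by
  ext x e
  · have h1 : e ∈ s.M x → e ∉ N.newPart t k U W' x := by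
      intro he he'
      obtain ⟨a, ha⟩ := e.ends_nonempty
      exact hkey x a (hs.graph x e he a ha) (hf.mem_keys_of_newPart he' ha)
    have h2 : e ∈ N.inPart t U W x → e ∈ s.M x := fun h => hfit.1 x h
    simp only [unfire, fire, Set.mem_union, Set.mem_sdiff]
    tauto
  · have h1 : e ∈ s.H x → ¬ (x = t ∧ e = k) := by
      rintro he ⟨-, rfl⟩
      exact lt_irrefl e (hk x e he)
    change (_ ∨ _) ∧ _ ↔ _
    tauto

/-- The later firing neither takes nor produces an item carrying `k`, and by `old_disjoint` it takes
nothing that undoing `(t, k)` puts back. The two changes act on disjoint items. -/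
theorem Undoable.unfire_fire_comm {t₁ : T} {k₁ : ℕ} {U₁ : V → TokenInst A V}
    {W₁ W₁' : Set (Item (TokenInst A V))} (hu : Undoable N M₀ s t k U W W')
    (hk : k < k₁) (hfit : N.Fits s.M t₁ U₁ W₁)
    (hin : ∀ x, ∀ e ∈ N.inPart t₁ U₁ W₁ x, ∀ a ∈ e.ends, k ∉ a.keys)
    (hout : ∀ x, ∀ e ∈ N.newPart t₁ k₁ U₁ W₁' x, ∀ a ∈ e.ends, k ∉ a.keys) :
    N.unfire (N.fire s t₁ k₁ U₁ W₁ W₁') t k U W W' =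
      N.fire (N.unfire s t k U W W') t₁ k₁ U₁ W₁ W₁' := by
  ext x e
  · have h1 : e ∈ N.newPart t₁ k₁ U₁ W₁' x → e ∉ N.newPart t k U W' x := by
      intro h h'
      obtain ⟨a, ha⟩ := e.ends_nonempty
      exact hout x e h a ha (hu.firing.mem_keys_of_newPart h' ha)
    have h2 : e ∈ N.inPart t U W x → e ∉ N.inPart t₁ U₁ W₁ x := by
      intro h h'
      obtain ⟨a, ha⟩ := e.ends_nonempty
      refine hu.old_disjoint x e (hfit.1 x h') (fun h'' => ?_) a ha
        (reach_subset _ _ (hu.firing.isGraph_inPart x e h a ha))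
      exact hin x e h' a ha (hu.firing.mem_keys_of_newPart h'' ha)
    simp only [unfire, fire, Set.mem_union, Set.mem_sdiff]
    tauto
  · have h1 : (x = t₁ ∧ e = k₁) → ¬ (x = t ∧ e = k) := by
      rintro ⟨-, rfl⟩ ⟨-, rfl⟩
      exact lt_irrefl _ hk
    change (_ ∨ _) ∧ _ ↔ (_ ∧ _) ∨ _
    tauto

/-- Induction on the forward execution. If `(t, k)` is the last firing, undoing it restores the
previous state; otherwise it is undone earlier and the last firing is replayed, which is possible
because that firing does not depend on `(t, k)`. -/
theorem Gapped.undoable (hM₀ : N.IsInitialMarking M₀) (h : N.Gapped M₀ s) :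
    ∀ t k, k ∈ s.H t → (∀ x a, Item.tok a ∈ s.M x → k ∈ a.keys → ∀ l ∈ a.keys, l ≤ k) →
      ∃ U W W', Undoable N M₀ s t k U W W' := by
  induction h with
  | init => exact fun _ _ h => h.elim
  | @fire s t₁ k₁ U₁ W₁ W₁' hg hk hf hfit ih =>
    intro t k hkt hlast
    have hs := hg.regular hM₀
    have hs' := hs.fire hk hf hfit
    have hkey : ∀ x a, Item.tok a ∈ s.M x → k₁ ∉ a.keys := by
      intro x a ha hka
      obtain ⟨t', ht'⟩ := hs.keys x a ha k₁ hka
      exact lt_irrefl k₁ (hk t' k₁ ht')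
    rcases hkt with hkt | ⟨rfl, rfl⟩
    · have hlt := hk t k hkt
      -- A token of `W₁` carrying `k` would become one carrying both `k` and the larger key `k₁`,
      -- against `hlast`.
      have hW : ∀ a, Item.tok a ∈ W₁ → k ∉ a.keys := by
        intro a ha hka
        obtain ⟨x, hx⟩ := hf.exists_outPart ((hf.switch.tok_mem_iff a).1 ha)
        have := hlast x (N.extend t₁ k₁ U₁ a) (Or.inr ⟨_, hx, rfl⟩)
          (TokenInst.mem_keys_step.2 (Or.inr hka)) k₁ (mem_keys_extend a)
        omega
      have hin : ∀ x, ∀ e ∈ N.inPart t₁ U₁ W₁ x, ∀ a ∈ e.ends, k ∉ a.keys := fun x e he a ha =>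
        hW a (reach_subset _ _ (hf.isGraph_inPart x e he a ha))
      have hout : ∀ x, ∀ e ∈ N.newPart t₁ k₁ U₁ W₁' x, ∀ a ∈ e.ends, k ∉ a.keys := by
        intro x e he a ha hka
        obtain ⟨b, -, hb, rfl⟩ := hf.tok_mem_of_newPart (hf.isGraph_newPart k₁ x e he a ha)
        rcases TokenInst.mem_keys_step.1 hka with h | h
        · omega
        · exact hW b hb h
      have hlast' : ∀ x a, Item.tok a ∈ s.M x → k ∈ a.keys → ∀ l ∈ a.keys, l ≤ k := by
        intro x a ha hka
        by_cases h : Item.tok a ∈ N.inPart t₁ U₁ W₁ x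
        · exact (hin x _ h a rfl hka).elim
        · exact hlast x a (Or.inl ⟨ha, h⟩) hka
      obtain ⟨U, W, W', hu⟩ := ih t k hkt hlast'
      refine ⟨U, W, W', hu.firing, ?_, ?_, ?_, ?_, ?_⟩
      · intro x e he
        obtain ⟨a, ha⟩ := e.ends_nonempty
        exact Or.inl ⟨hu.new_subset x he,
          fun h => hin x e h a ha (hu.firing.mem_keys_of_newPart he ha)⟩
      · rintro x a b (hab | hab) ha
        · exact hu.new_closed x a b hab.1 ha
        · exact (hout x _ hab a (by simp) (hu.firing.mem_keys_of_newPart ha rfl)).elim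
      · rintro x e (he | he) hnew a ha
        · exact hu.old_disjoint x e he.1 hnew a ha
        -- Tokens of `W` lie in the unfired state before the last firing, where the key `k₁` has not
        -- been used yet.
        · intro haW
          obtain ⟨y, hy⟩ := hu.firing.exists_inPart haW
          obtain ⟨t', ht', -⟩ := (hu.gapped.regular hM₀).keys y a (Or.inr hy) k₁
            (hf.mem_keys_of_newPart he ha)
          exact lt_irrefl k₁ (hk t' k₁ ht')
      · rintro x a (ha | ha) hka
        · exact hu.keys x a ha.1 hka
        · exact (hout x _ ha a rfl hka).elim
      · rw [hu.unfire_fire_comm hlt hfit hin hout]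
        refine hu.gapped.fire (fun t' l hl => hk t' l hl.1) hf ⟨?_, ?_⟩
        · intro x e he
          refine Or.inl ⟨hfit.1 x he, fun h => ?_⟩
          obtain ⟨a, ha⟩ := e.ends_nonempty
          exact hin x e he a ha (hu.firing.mem_keys_of_newPart h ha)
        · rintro x a b (hab | hab) ha
          · exact hfit.2 x a b hab.1 ha
          · obtain ⟨y, hy, hyM⟩ := hfit.exists_mem hf ha
            refine (hu.old_disjoint y _ hyM (fun h => ?_) a rfl ?_).elim
            · exact hin y _ hy a rfl (hu.firing.mem_keys_of_newPart h rfl)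
            · exact reach_subset _ _ (hu.firing.isGraph_inPart x _ hab a (by simp))
    · refine ⟨U₁, W₁, W₁', hf, fun x => Set.subset_union_right, ?_, ?_, ?_, ?_⟩
      · rintro x a b (hab | hab) ha
        · exact (hkey x a (hs.graph x _ hab.1 a (by simp)) (hf.mem_keys_of_newPart ha rfl)).elim
        · exact hab
      · rintro x e (he | he) hnew a ha
        · exact hfit.not_mem_of_mem_diff hf hs he ha
        · exact (hnew he).elim
      · rintro x a (ha | ha) hka
        · exact (hkey x a ha.1 hka).elim
        · exact ha
      · rw [unfire_fire hs hk hf hfit hkey]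
        exact hg

/-! ### Forward steps -/

theorem isGraph_arcIn (N : MRPN P T A V) (x : P) (t : T) : IsGraph (N.arcIn x t) :=
  isGraph_iff.2 fun u v h => ⟨(N.arcIn_bond x t u v h).1, (N.arcIn_bond x t u v h).2.1⟩

theorem isGraph_arcOut (N : MRPN P T A V) (t : T) (x : P) : IsGraph (N.arcOut t x) :=
  isGraph_iff.2 fun u v h => ⟨(N.arcOut_bond t x u v h).1, (N.arcOut_bond t x u v h).2.1⟩

theorem mem_pre {x : P} {e : Item V} (he : e ∈ N.arcIn x t) : e.map U ∈ N.pre t U :=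
  ⟨e, Set.mem_iUnion.2 ⟨x, he⟩, rfl⟩

theorem mem_post {x : P} {e : Item V} (he : e ∈ N.arcOut t x) : e.map U ∈ N.post t U :=
  ⟨e, Set.mem_iUnion.2 ⟨x, he⟩, rfl⟩

theorem tok_pre_iff_post (hN : N.WellFormed) (a : TokenInst A V) :
    Item.tok a ∈ N.pre t U ↔ Item.tok a ∈ N.post t U := by
  simp only [pre, post, Item.tok_mem_map_image, (hN t).1]

namespace FwdAssignment

theorem fwdIn_eq (hU : N.FwdAssignment s t U) (hs : N.Regular M₀ s) (x : P) :
    N.fwdIn s t U x = reach (s.M x) (U '' {u | Item.tok u ∈ N.arcIn x t}) := by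
  ext e
  constructor
  · rintro ⟨u, hu, he⟩
    obtain ⟨he, b, hb, hab⟩ := (mem_connected (hs.graph x) (hU.2.1 x u hu).1).1 he
    exact ⟨he, U u, ⟨u, hu, rfl⟩, b, hb, hab⟩
  · rintro ⟨he, _, ⟨u, hu, rfl⟩, b, hb, hab⟩
    exact ⟨u, hu, (mem_connected (hs.graph x) (hU.2.1 x u hu).1).2 ⟨he, b, hb, hab⟩⟩

theorem bond_mem_iUnion_fwdIn (hU : N.FwdAssignment s t U) (hs : N.Regular M₀ s) {x : P}
    {a b : TokenInst A V} (hab : Item.bond s(a, b) ∈ s.M x)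
    (ha : Item.tok a ∈ ⋃ y, N.fwdIn s t U y) : Item.bond s(a, b) ∈ ⋃ y, N.fwdIn s t U y := by
  obtain ⟨y, hy⟩ := Set.mem_iUnion.1 ha
  rw [hU.fwdIn_eq hs] at hy
  obtain rfl := hs.uniq x y a (hs.graph x _ hab a (by simp)) (reach_subset _ _ hy)
  refine Set.mem_iUnion.2 ⟨x, ?_⟩
  rw [hU.fwdIn_eq hs]
  exact bond_mem_reach hab hy

theorem isGraph_iUnion_fwdIn (hU : N.FwdAssignment s t U) (hs : N.Regular M₀ s) :
    IsGraph (⋃ y, N.fwdIn s t U y) := by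
  refine IsGraph.iUnion fun y => ?_
  rw [hU.fwdIn_eq hs]
  exact isGraph_reach (hs.graph y) _

theorem iUnion_fwdIn_subset (hU : N.FwdAssignment s t U) (hs : N.Regular M₀ s) :
    ⋃ y, N.fwdIn s t U y ⊆ ⋃ y, s.M y :=
  Set.iUnion_mono fun y => (hU.fwdIn_eq hs y).le.trans (reach_subset _ _)

theorem pre_subset (hU : N.FwdAssignment s t U) (hs : N.Regular M₀ s) :
    N.pre t U ⊆ ⋃ y, N.fwdIn s t U y := by
  rintro _ ⟨e, he, rfl⟩
  obtain ⟨x, hx⟩ := Set.mem_iUnion.1 he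
  refine Set.mem_iUnion.2 ⟨x, ?_⟩
  rw [hU.fwdIn_eq hs]
  obtain ⟨u, hu⟩ := e.ends_nonempty
  refine ⟨?_, U u, ⟨u, N.isGraph_arcIn x t e hx u hu, rfl⟩, U u, Item.mem_ends_map.2 ⟨u, hu, rfl⟩,
    Conn.refl _ _⟩
  cases e with
  | tok v => exact (hU.2.1 x v hx).1
  | bond p =>
    induction p with
    | h v w => exact hU.2.2.1 x v w hx

theorem conn_place (hU : N.FwdAssignment s t U) (hs : N.Regular M₀ s) {x : P}
    {a b : TokenInst A V} (ha : Item.tok a ∈ s.M x) (h : Conn (⋃ y, N.fwdIn s t U y) a b) :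
    Conn (s.M x) a b := by
  refine h.of_closed (hs.graph x) ha fun c d hcd hc => ?_
  obtain ⟨y, hy⟩ := Set.mem_iUnion.1 (hU.iUnion_fwdIn_subset hs hcd)
  rwa [hs.uniq x y c hc (hs.graph y _ hy c (by simp))]

theorem inPart_eq (hU : N.FwdAssignment s t U) (hs : N.Regular M₀ s) (x : P) :
    N.inPart t U (⋃ y, N.fwdIn s t U y) x = N.fwdIn s t U x := by
  rw [hU.fwdIn_eq hs]
  ext e
  constructor
  · rintro ⟨he, _, ⟨u, hu, rfl⟩, b, hb, hub⟩
    have hux := (hU.2.1 x u hu).1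
    have hub' := hU.conn_place hs hux hub
    obtain ⟨y, hy⟩ := Set.mem_iUnion.1 (hU.iUnion_fwdIn_subset hs he)
    obtain rfl := hs.uniq x y b (hub'.tok_mem (hs.graph x) hux) (hs.graph y _ hy b hb)
    exact ⟨hy, U u, ⟨u, hu, rfl⟩, b, hb, hub'⟩
  · rintro ⟨he, _, ⟨u, hu, rfl⟩, b, hb, hub⟩
    refine ⟨Set.mem_iUnion.2 ⟨x, ?_⟩, U u, ⟨u, hu, rfl⟩, b, hb,
      hub.of_closed (hU.isGraph_iUnion_fwdIn hs) (hU.pre_subset hs (mem_pre hu))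
        fun c d hcd => hU.bond_mem_iUnion_fwdIn hs hcd⟩
    rw [hU.fwdIn_eq hs]
    exact ⟨he, U u, ⟨u, hu, rfl⟩, b, hb, hub⟩

theorem fits (hU : N.FwdAssignment s t U) (hs : N.Regular M₀ s) :
    N.Fits s.M t U (⋃ y, N.fwdIn s t U y) := by
  constructor
  · intro x
    rw [hU.inPart_eq hs, hU.fwdIn_eq hs]
    exact reach_subset _ _
  · exact fun x a b hab => hU.bond_mem_iUnion_fwdIn hs hab

/-- A bond already present between two selected tokens lies in their common place, so the enabling
condition on existing bonds forces it into the guard. Without this, removing the effects again could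
destroy an old bond. -/
theorem mem_pre_of_mem_post (hU : N.FwdAssignment s t U) (hs : N.Regular M₀ s)
    (hN : N.WellFormed) {e : Item (TokenInst A V)} (he : e ∈ ⋃ y, N.fwdIn s t U y)
    (hpost : e ∈ N.post t U) : e ∈ N.pre t U := by
  cases e with
  | tok a => exact (tok_pre_iff_post hN a).2 hpost
  | bond p =>
    obtain ⟨x, hx⟩ := Set.mem_iUnion.1 (hU.iUnion_fwdIn_subset hs he)
    induction p with
    | h a b =>
      obtain ⟨u, v, huv, rfl, rfl⟩ := Item.bond_mem_map_image.1 hpost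
      have hends := isGraph_iff.1 (IsGraph.iUnion (N.isGraph_arcOut t)) _ _ huv
      obtain ⟨y, hy⟩ := Set.mem_iUnion.1 (((hN t).1 u).2 hends.1)
      obtain ⟨z, hz⟩ := Set.mem_iUnion.1 (((hN t).1 v).2 hends.2)
      obtain rfl := hs.uniq x y _ (hs.graph x _ hx (U u) (by simp)) (hU.2.1 y u hy).1
      obtain rfl := hs.uniq x z _ (hs.graph x _ hx (U v) (by simp)) (hU.2.1 z v hz).1
      exact mem_pre (hU.2.2.2.1 x u v hy hz hx)

/-- The components that `t` puts into different places are not connected within one place. -/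
theorem local_hom (hU : N.FwdAssignment s t U) (hs : N.Regular M₀ s) (hN : N.WellFormed)
    (x y z : P) (u v : V) (hu : Item.tok u ∈ N.arcOut t x) (hv : Item.tok v ∈ N.arcOut t y)
    (huz : Item.tok (U u) ∈ s.M z)
    (huv : Conn ((s.M z \ N.pre t U) ∪ N.post t U) (U u) (U v)) : x = y := by
  by_contra hxy
  obtain ⟨z', hz'⟩ := Set.mem_iUnion.1 (((hN t).1 u).2 (Set.mem_iUnion.2 ⟨x, hu⟩))
  obtain rfl := hs.uniq z z' _ huz (hU.2.1 z' u hz').1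
  have hgraph : IsGraph ((s.M z \ N.pre t U) ∪ N.post t U) :=
    (hs.graph z).switch ((IsGraph.iUnion (N.isGraph_arcOut t)).map U)
      fun a => (tok_pre_iff_post hN a).1
  refine hU.2.2.2.2 x y u v hu hv hxy z ⟨_, hz'⟩ ?_
  rw [tok_mem_connected hgraph (Or.inr (mem_post hv))]
  exact huv.symm

theorem mem_iUnion_of_arcOut (hU : N.FwdAssignment s t U) (hs : N.Regular M₀ s)
    (hN : N.WellFormed) (x : P) (u : V) (hu : Item.tok u ∈ N.arcOut t x) :
    Item.tok (U u) ∈ ⋃ y, N.fwdIn s t U y :=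
  hU.pre_subset hs ((tok_pre_iff_post hN _).2 (mem_post hu))

/-- Forward execution forms components place by place, with all of the effects added to each place;
this replaces them by one reachability in the global exchange. -/
theorem fwdOut_eq (hU : N.FwdAssignment s t U) (hs : N.Regular M₀ s) (hN : N.WellFormed) (x : P) :
    N.fwdOut s t U x =
      N.outPart t U (((⋃ y, N.fwdIn s t U y) \ N.pre t U) ∪ N.post t U) x :=
  setOf_local_connected_eq_reach hs.uniq hs.graph (hU.isGraph_iUnion_fwdIn hs)
    (hU.iUnion_fwdIn_subset hs) (fun _ _ _ h => hU.bond_mem_iUnion_fwdIn hs h)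
    (N.isGraph_arcOut t) (hU.mem_iUnion_of_arcOut hs hN) (fun a => (tok_pre_iff_post hN a).1)
    (hU.local_hom hs hN) x

theorem firing (hU : N.FwdAssignment s t U) (hs : N.Regular M₀ s) (hN : N.WellFormed) :
    N.Firing t U (⋃ y, N.fwdIn s t U y)
      (((⋃ y, N.fwdIn s t U y) \ N.pre t U) ∪ N.post t U) := by
  have hpost : IsGraph (N.post t U) := (IsGraph.iUnion (N.isGraph_arcOut t)).map U
  have hW := hU.isGraph_iUnion_fwdIn hs
  refine ⟨hU.1, fun x => N.isGraph_arcIn x t, N.isGraph_arcOut t, (hN t).1, hW,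
    hW.switch hpost fun a => (tok_pre_iff_post hN a).1, rfl, ?_, ?_, ?_, ?_, ?_⟩
  -- Invertibility needs exactly that the effects add nothing already present in `W`, apart from
  -- items of the guard.
  · ext e
    have h1 : e ∈ N.pre t U → e ∈ ⋃ y, N.fwdIn s t U y := fun h => hU.pre_subset hs h
    have h2 := fun h h' => hU.mem_pre_of_mem_post hs hN (e := e) h h'
    change _ ↔ ((e ∈ _ ∧ e ∉ N.pre t U) ∨ e ∈ N.post t U) ∧ e ∉ N.post t U ∨ e ∈ N.pre t U
    tauto
  · intro x y u v hu hv huv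
    have hux := (hU.2.1 x u hu).1
    exact hs.uniq x y _ ((hU.conn_place hs hux huv).tok_mem (hs.graph x) hux) (hU.2.1 y v hv).1
  · intro x y u v hu hv huv
    obtain ⟨w, z, hw, hwz, -, hwv⟩ := exists_local_conn hs.uniq hs.graph
      (hU.iUnion_fwdIn_subset hs) (N.isGraph_arcOut t) (hU.mem_iUnion_of_arcOut hs hN)
      (hU.local_hom hs hN) hu huv
    exact hU.local_hom hs hN x y z w v hw hv hwz hwv
  · intro e he
    obtain ⟨x, hx⟩ := Set.mem_iUnion.1 he
    rw [← hU.inPart_eq hs] at hx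
    exact ⟨x, hx⟩
  -- Follow a path in `W`. A bond of the guard may be removed, but its far end is again a selected
  -- token, from which the path restarts; all other bonds survive the exchange.
  · have key : ∀ u x b, Item.tok u ∈ N.arcIn x t → Conn (⋃ y, N.fwdIn s t U y) (U u) b →
        ∃ v y, Item.tok v ∈ N.arcOut t y ∧
          Conn (((⋃ y, N.fwdIn s t U y) \ N.pre t U) ∪ N.post t U) (U v) b := by
      have hvar : ∀ v, Item.tok v ∈ N.guard t → ∃ y, Item.tok v ∈ N.arcOut t y :=
        fun v hv => Set.mem_iUnion.1 (((hN t).1 v).1 hv)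
      intro u x b hu hub
      induction hub with
      | refl =>
        obtain ⟨y, hy⟩ := hvar u (Set.mem_iUnion.2 ⟨x, hu⟩)
        exact ⟨u, y, hy, Conn.refl _ _⟩
      | @tail b c _ hbc ih =>
        by_cases hpre : Item.bond s(b, c) ∈ N.pre t U
        · obtain ⟨v, v', hv, -, rfl⟩ := Item.bond_mem_map_image.1 hpre
          obtain ⟨y, hy⟩ := hvar v'
            (isGraph_iff.1 (IsGraph.iUnion fun x => N.isGraph_arcIn x t) _ _ hv).2
          exact ⟨v', y, hy, Conn.refl _ _⟩
        · obtain ⟨v, y, hv, hvb⟩ := ih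
          exact ⟨v, y, hv, hvb.tail (Or.inl ⟨hbc, hpre⟩)⟩
    rintro e he
    rcases id he with ⟨heW, -⟩ | ⟨e, hepost, rfl⟩
    · obtain ⟨x, hx⟩ := Set.mem_iUnion.1 heW
      rw [← hU.inPart_eq hs] at hx
      obtain ⟨-, _, ⟨u, hu, rfl⟩, b, hb, hub⟩ := hx
      obtain ⟨v, y, hv, hvb⟩ := key u x b hu hub
      exact ⟨y, he, U v, ⟨v, hv, rfl⟩, b, hb, hvb⟩
    · obtain ⟨u, hu⟩ := e.ends_nonempty
      obtain ⟨x, hx⟩ := Set.mem_iUnion.1 hepost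
      exact ⟨x, he, U u, ⟨u, N.isGraph_arcOut t x e hx u hu, rfl⟩, U u,
        Item.mem_ends_map.2 ⟨u, hu, rfl⟩, Conn.refl _ _⟩

end FwdAssignment

/-- The key `m + 1` exceeds every key in the current history, which is all that `Gapped` asks for;
this survives the holes left by reversals. -/
theorem Gapped.fwdStep (hM₀ : N.IsInitialMarking M₀) (hN : N.WellFormed) (h : N.Gapped M₀ s)
    (hstep : N.FwdStep s t k s') : N.Gapped M₀ s' := by
  have hs := h.regular hM₀
  obtain ⟨⟨m, hm, rfl⟩, ⟨U, hU, hM⟩, hH⟩ := hstep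
  have hs' : s' = N.fire s t (m + 1) U (⋃ y, N.fwdIn s t U y)
      (((⋃ y, N.fwdIn s t U y) \ N.pre t U) ∪ N.post t U) := by
    apply State.ext
    · funext x
      rw [hM x, hU.fwdOut_eq hs hN, ← hU.inPart_eq hs x]
      rfl
    · funext t'
      ext l
      exact hH t' l
  rw [hs']
  exact h.fire (fun t' l hl => Nat.lt_succ_of_le (hm.2 (Or.inr ⟨t', hl⟩))) (hU.firing hs hN)
    (hU.fits hs)

end MRPN

/-- An item of `C` with an end in a union of connected components belongs to it. -/
theorem mem_of_ends_mem {X : Type*} {C D : Set (Item X)} {e : Item X} (he : e ∈ C) {a : X}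
    (ha : a ∈ e.ends) (haD : Item.tok a ∈ D)
    (hCD : ∀ a b, Item.bond s(a, b) ∈ C → Item.tok a ∈ D → Item.bond s(a, b) ∈ D) : e ∈ D := by
  cases e with
  | tok b => obtain rfl := Item.mem_ends_tok.1 ha; exact haD
  | bond p =>
    obtain ⟨b, rfl⟩ := Sym2.mem_iff_exists.1 (Item.mem_ends_bond.1 ha)
    exact hCD a b he haD

theorem connected_subset {X : Type*} {C : Set (Item X)} (hC : IsGraph C) (a : X) :
    connected a C ⊆ C := by
  rintro e (⟨rfl, h⟩ | ⟨b, c, -, h, rfl | rfl | rfl⟩)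
  exacts [h, h.1, (isGraph_iff.1 hC _ _ h.1).1, h.2]

/-! ### Causal reversal computes the unfired state. -/

namespace MRPN

variable {P T A V : Type*} {N : MRPN P T A V} {M₀ : Marking P A V} {s s' : State P T A V} {t : T}
  {k : ℕ} {U U' : V → TokenInst A V} {W W' : Set (Item (TokenInst A V))}

theorem map_image_comp {X Y Z : Type*} (f : X → Y) (g : Y → Z) (E : Set (Item X)) :
    Item.map (g ∘ f) '' E = Item.map g '' (Item.map f '' E) := by
  rw [Set.image_image]
  simp only [Item.map_map]

theorem image_map_congr {X Y : Type*} {f g : X → Y} {E : Set (Item X)} (hE : IsGraph E)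
    (h : ∀ a, Item.tok a ∈ E → f a = g a) : Item.map f '' E = Item.map g '' E :=
  Set.image_congr fun e he => Item.map_congr fun a ha => h a (hE e he a ha)

theorem pre_eq_image (hU' : ∀ u, Item.tok u ∈ N.guard t → U' u = N.extend t k U (U u)) :
    N.pre t U' = Item.map (N.extend t k U) '' N.pre t U := by
  unfold pre
  rw [← map_image_comp]
  exact image_map_congr (IsGraph.iUnion fun x => N.isGraph_arcIn x t) hU'

namespace Undoable

theorem post_eq (hu : Undoable N M₀ s t k U W W')
    (hU' : ∀ u, Item.tok u ∈ N.guard t → U' u = N.extend t k U (U u)) :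
    N.post t U' = Item.map (N.extend t k U) '' N.post t U := by
  unfold post
  rw [← map_image_comp]
  exact image_map_congr (IsGraph.iUnion (N.isGraph_arcOut t))
    fun u h => hU' u ((hu.firing.guard_iff_effects u).2 h)

theorem map_mem_newPart (hu : Undoable N M₀ s t k U W W') {e : Item (TokenInst A V)} (he : e ∈ W') :
    ∃ x, e.map (N.extend t k U) ∈ N.newPart t k U W' x := by
  obtain ⟨x, hx⟩ := hu.firing.exists_outPart he
  exact ⟨x, e, hx, rfl⟩

theorem image_subset (hu : Undoable N M₀ s t k U W W')
    : Item.map (N.extend t k U) '' W' ⊆ ⋃ x, s.M x := by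
  rintro _ ⟨e, he, rfl⟩
  obtain ⟨x, hx⟩ := hu.map_mem_newPart he
  exact Set.mem_iUnion.2 ⟨x, hu.new_subset x hx⟩

theorem newPart_eq (hu : Undoable N M₀ s t k U W W')
    (x : P) : N.newPart t k U W' x = reach (Item.map (N.extend t k U) '' W')
    (N.extend t k U ∘ U '' {u | Item.tok u ∈ N.arcOut t x}) := by
  rw [newPart, outPart, map_image_reach hu.firing.switch.graph' extend_injective.injOn,
    Set.image_comp]
  rintro _ ⟨u, hux, rfl⟩
  exact hu.firing.switch.symm.var_mem hux

theorem mem_newPart (hu : Undoable N M₀ s t k U W W')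
    (hs : N.Regular M₀ s) {x : P} {e : Item (TokenInst A V)} (he : e ∈ s.M x)
    (he' : e ∈ Item.map (N.extend t k U) '' W') : e ∈ N.newPart t k U W' x := by
  obtain ⟨e, heW, rfl⟩ := he'
  obtain ⟨y, hy⟩ := hu.map_mem_newPart heW
  obtain ⟨a, ha⟩ := (e.map (N.extend t k U)).ends_nonempty
  rwa [hs.uniq x y a (hs.graph x _ he a ha) (hs.graph y _ (hu.new_subset y hy) a ha)]

theorem closed_image (hu : Undoable N M₀ s t k U W W')
    (hs : N.Regular M₀ s) (x : P) (a b : TokenInst A V)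
    (hab : Item.bond s(a, b) ∈ s.M x) (ha : Item.tok a ∈ Item.map (N.extend t k U) '' W') :
    Item.bond s(a, b) ∈ Item.map (N.extend t k U) '' W' := by
  have h := hu.new_closed x a b hab (hu.mem_newPart hs (hs.graph x _ hab a (by simp)) ha)
  exact Set.image_mono (reach_subset _ _) h

theorem var_mem_newPart (hu : Undoable N M₀ s t k U W W')
    {x : P} {u : V} (hux : Item.tok u ∈ N.arcOut t x) :
    Item.tok (N.extend t k U (U u)) ∈ N.newPart t k U W' x :=
  ⟨Item.tok (U u), ⟨hu.firing.switch.symm.var_mem hux, U u, ⟨u, hux, rfl⟩, U u, rfl,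
    Conn.refl _ _⟩, rfl⟩

/-- The new part of a place is still intact and closed under the bonds of that place, so the
components of the selected tokens are just this part. -/
theorem revIn_eq (hu : Undoable N M₀ s t k U W W') (hs : N.Regular M₀ s)
    (hU' : ∀ u, Item.tok u ∈ N.guard t → U' u = N.extend t k U (U u)) (x : P) :
    N.revIn s t U' x = N.newPart t k U W' x := by
  have hU'' : ∀ {u}, Item.tok u ∈ N.arcOut t x → U' u = N.extend t k U (U u) := fun {u} h =>
    hU' u ((hu.firing.guard_iff_effects u).2 (Set.mem_iUnion.2 ⟨x, h⟩))
  have hgraph := hu.firing.isGraph_newPart k x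
  ext e
  constructor
  · rintro ⟨u, hux, he⟩
    have hn := hu.var_mem_newPart hux
    rw [hU'' hux, mem_connected (hs.graph x) (hu.new_subset x hn)] at he
    obtain ⟨he, b, hb, hub⟩ := he
    have hbn := (hub.of_closed hgraph hn (hu.new_closed x)).tok_mem hgraph hn
    exact mem_of_ends_mem he hb hbn (hu.new_closed x)
  · intro he
    have he' := he
    rw [hu.newPart_eq] at he
    obtain ⟨he, _, ⟨u, hux, rfl⟩, b, hb, hub⟩ := he
    have hn := hu.var_mem_newPart hux
    refine ⟨u, hux, ?_⟩
    rw [hU'' hux, mem_connected (hs.graph x) (hu.new_subset x hn)]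
    refine ⟨hu.new_subset x he', b, hb, ?_⟩
    refine (Conn.of_closed hgraph hub hn ?_).mono (hu.new_subset x)
    rw [hu.newPart_eq]
    exact fun a b => bond_mem_reach

/-- The exchange, transported to extended memories, is run backwards: replacing the effects by the
guard turns the image of `W'` into that of `W`. -/
theorem revOut_eq (hu : Undoable N M₀ s t k U W W') (hs : N.Regular M₀ s)
    (hU' : ∀ u, Item.tok u ∈ N.guard t → U' u = N.extend t k U (U u)) (x : P) :
    N.revOut s t U' x = Item.map (N.extend t k U) '' N.inPart t U W x := by
  have hsw := hu.firing.switch.map (g := N.extend t k U) extend_injective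
  have hpre : N.pre t U' = N.pre t (N.extend t k U ∘ U) := by
    rw [pre_eq_image hU', pre_eq_image (U' := N.extend t k U ∘ U) fun _ _ => rfl]
  have hpost : N.post t U' = N.post t (N.extend t k U ∘ U) := by
    rw [hu.post_eq hU', hu.post_eq (U' := N.extend t k U ∘ U) fun _ _ => rfl]
  -- `U'` is only known at the variables of `t`, so it is first replaced by an assignment that is
  -- known everywhere.
  have hrev : N.revOut s t U' x = N.revOut s t (N.extend t k U ∘ U) x := by
    have hvar : ∀ u, Item.tok u ∈ N.arcIn x t → U' u = (N.extend t k U ∘ U) u := fun u h =>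
      hU' u (Set.mem_iUnion.2 ⟨x, h⟩)
    ext e
    constructor
    · rintro ⟨u, y, h1, h2, h3⟩
      rw [hvar u h1] at h2 h3
      rw [hpre, hpost] at h3
      exact ⟨u, y, h1, h2, h3⟩
    · rintro ⟨u, y, h1, h2, h3⟩
      rw [← hvar u h1] at h2 h3
      rw [← hpre, ← hpost] at h3
      exact ⟨u, y, h1, h2, h3⟩
  have hmain : N.revOut s t (N.extend t k U ∘ U) x =
      reach ((Item.map (N.extend t k U) '' W' \ N.post t (N.extend t k U ∘ U)) ∪
        N.pre t (N.extend t k U ∘ U)) (N.extend t k U ∘ U '' {u | Item.tok u ∈ N.arcIn x t}) := by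
    refine setOf_local_connected_eq_reach hs.uniq hs.graph hsw.graph' hu.image_subset
      (hu.closed_image hs) hsw.label
      (fun y u h => (hsw.tok_mem_iff _).1 (hsw.var_mem h)) (fun a => (hsw.tok_pre_iff a).2) ?_ x
    intro y y' z u v hy hy' _ huv
    have huW := hsw.var_mem hy
    refine hsw.hom y y' u v hy hy' (huv.of_closed hsw.graph huW ?_)
    intro a b hab ha
    rw [hsw.eq]
    rcases hab with hab | hab
    · exact Or.inl ⟨hu.closed_image hs z a b hab.1 ((hsw.tok_mem_iff a).1 ha), hab.2⟩
    · exact Or.inr hab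
  have heq : (Item.map (N.extend t k U) '' W' \ N.post t (N.extend t k U ∘ U)) ∪
      N.pre t (N.extend t k U ∘ U) = Item.map (N.extend t k U) '' W := hsw.eq.symm
  rw [hrev, hmain, heq, inPart, map_image_reach hu.firing.switch.graph extend_injective.injOn,
    Set.image_comp]
  rintro _ ⟨u, hux, rfl⟩
  exact hu.firing.switch.var_mem hux

theorem revMarking_eq (hu : Undoable N M₀ s t k U W W') (hs : N.Regular M₀ s)
    (hU' : ∀ u, Item.tok u ∈ N.guard t → U' u = N.extend t k U (U u)) :
    N.revMarking s t k U' = (N.unfire s t k U W W').M := by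
  funext x
  have htok : ∀ a u, Item.tok (TokenInst.step a k u) ∈
      Item.map (N.extend t k U) '' N.inPart t U W x → Item.tok a ∈ N.inPart t U W x := by
    intro a u h
    obtain ⟨b, hb, h⟩ := Item.tok_mem_map_image.1 h
    rwa [← (TokenInst.step.inj h).1]
  have hbond : ∀ a b u v, Item.bond s(TokenInst.step a k u, TokenInst.step b k v) ∈
      Item.map (N.extend t k U) '' N.inPart t U W x → Item.bond s(a, b) ∈ N.inPart t U W x := by
    intro a b u v h
    obtain ⟨c, d, hcd, h, h'⟩ := Item.bond_mem_map_image.1 h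
    rwa [← (TokenInst.step.inj h).1, ← (TokenInst.step.inj h').1]
  simp only [revMarking, unfire, hu.revIn_eq hs hU', hu.revOut_eq hs hU']
  congr 1
  ext e
  constructor
  · rintro (⟨a, u, rfl, h⟩ | ⟨a, b, u, v, rfl, h⟩)
    · exact htok a u h
    · exact hbond a b u v h
  · intro he
    cases e with
    | tok a => exact Or.inl ⟨a, _, rfl, _, he, rfl⟩
    | bond p =>
      induction p with
      | h a b => exact Or.inr ⟨a, b, _, _, rfl, _, he, rfl⟩

/-! ### Assignments of the undone occurrence -/

theorem not_mem_keys_of_unfire (hu : Undoable N M₀ s t k U W W')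
    (hM₀ : N.IsInitialMarking M₀) (hs : N.Regular M₀ s) (hk : k ∈ s.H t) {x : P}
    {a : TokenInst A V} (ha : Item.tok a ∈ (N.unfire s t k U W W').M x) : k ∉ a.keys := by
  intro hka
  obtain ⟨t', ht', hne⟩ := (hu.gapped.regular hM₀).keys x a ha k hka
  exact hne ⟨hs.hist t' t k ht' hk, rfl⟩

theorem not_mem_keys (hu : Undoable N M₀ s t k U W W')
    (hM₀ : N.IsInitialMarking M₀) (hs : N.Regular M₀ s) (hk : k ∈ s.H t)
    {a : TokenInst A V} (ha : Item.tok a ∈ W) : k ∉ a.keys := by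
  obtain ⟨x, hx⟩ := hu.firing.exists_inPart ha
  exact hu.not_mem_keys_of_unfire hM₀ hs hk (x := x) (Or.inr hx)

/-- A token carrying `k` extends a token of `W`, which does not carry `k` itself. Hence the memory
`k` is the outermost one, and its variable determines the token. This makes the selected tokens
unique, even under the weaker requirement of out-of-causal reversal. -/
theorem eq_extend (hu : Undoable N M₀ s t k U W W')
    (hM₀ : N.IsInitialMarking M₀) (hs : N.Regular M₀ s) (hk : k ∈ s.H t) {x : P}
    {a b : TokenInst A V} {u : V} (ha : Item.tok a ∈ s.M x)
    (h : (TokenInst.step b k (some u)).EvolvesTo a) : a = N.extend t k U (U u) := by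
  have hn := hu.keys x a ha (TokenInst.mem_keys_of_evolvesTo h)
  obtain ⟨c, -, hc, rfl⟩ := hu.firing.tok_mem_of_newPart hn
  rcases TokenInst.evolvesTo_step.1 h with h | h
  · obtain ⟨rfl, -, h⟩ := TokenInst.step.inj h
    rw [(varOf_eq_some h.symm).2]
  · exact (hu.not_mem_keys hM₀ hs hk hc (TokenInst.mem_keys_of_evolvesTo h)).elim

theorem revAssignment_eq (hu : Undoable N M₀ s t k U W W')
    (hM₀ : N.IsInitialMarking M₀) (hs : N.Regular M₀ s) (hk : k ∈ s.H t)
    (hU' : N.RevAssignment s t k U') (u : V) (hug : Item.tok u ∈ N.guard t) :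
    U' u = N.extend t k U (U u) := by
  obtain ⟨x, hx⟩ := Set.mem_iUnion.1 ((hu.firing.guard_iff_effects u).1 hug)
  obtain ⟨⟨a, ha⟩, hux, -⟩ := hU'.2.1 x u hx
  exact hu.eq_extend (b := a) hM₀ hs hk hux (by rw [ha]; exact .refl _)

theorem oAssignment_eq (hu : Undoable N M₀ s t k U W W')
    (hM₀ : N.IsInitialMarking M₀) (hs : N.Regular M₀ s)
    (hU' : N.OAssignment s t k U') (u : V) (hug : Item.tok u ∈ N.guard t) :
    U' u = N.extend t k U (U u) := by
  obtain ⟨⟨a, ha⟩, ⟨x, hux⟩, -⟩ := hU'.2.2.1 u ((hu.firing.guard_iff_effects u).1 hug)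
  exact hu.eq_extend hM₀ hs hU'.1 hux ha

end Undoable

/-- The clauses about undone bonds hold vacuously: a later memory on a selected token would exhibit
a causal successor. -/
theorem CAssignment.oAssignment (hN : N.WellFormed) (hU : N.CAssignment s t k U) :
    N.OAssignment s t k U := by
  obtain ⟨⟨hk, hc⟩, hinj, htok, hbond⟩ := hU
  have hlater : ∀ u, Item.tok u ∈ N.effects t → ∀ a k' u',
      (TokenInst.step a k' (some u')).EvolvesTo (U u) → ¬ ∃ t', k' ∈ s.H t' ∧ k < k' := by
    rintro u hu a k' u' hk' ⟨t', ht', hlt⟩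
    obtain ⟨x, hx⟩ := Set.mem_iUnion.1 hu
    obtain ⟨⟨b, hb⟩, hux, -⟩ := htok x u hx
    exact hc ⟨t', k', hk, ht', hlt, x, U u, hux, ⟨b, some u, hb ▸ .refl _⟩, ⟨a, some u', hk'⟩⟩
  refine ⟨hk, hinj, ?_, ?_, ?_, ?_⟩
  · intro u hu
    obtain ⟨x, hx⟩ := Set.mem_iUnion.1 hu
    obtain ⟨⟨b, hb⟩, hux, ht⟩ := htok x u hx
    exact ⟨⟨b, hb ▸ .refl _⟩, ⟨x, hux⟩, ht⟩
  · intro u v huv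
    obtain ⟨x, hx⟩ := Set.mem_iUnion.1 huv
    exact ⟨x, hbond x u v hx⟩
  · rintro u v huv - a b k' u' v' hk' - ⟨t', ht', hlt, -⟩
    have hug := (isGraph_iff.1 (IsGraph.iUnion fun x => N.isGraph_arcIn x t) _ _ huv).1
    exact hlater u (((hN t).1 u).1 hug) a k' u' hk' ⟨t', ht', hlt⟩
  · rintro u v huv - a b k' u' v' hk' - ⟨t', ht', hlt, -⟩
    have hue := (isGraph_iff.1 (IsGraph.iUnion (N.isGraph_arcOut t)) _ _ huv).1
    exact hlater u hue a k' u' hk' ⟨t', ht', hlt⟩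

end MRPN

/-! ### Out-of-causal reversal computes the unfired state. -/

namespace MRPN

variable {P T A V : Type*} {N : MRPN P T A V} {M₀ : Marking P A V} {s s' : State P T A V} {t : T}
  {k : ℕ} {U U' : V → TokenInst A V} {W W' : Set (Item (TokenInst A V))}

namespace Regular

theorem exists_isLastT (hs : N.Regular M₀ s) {x : P} {a : TokenInst A V}
    (ha : Item.tok a ∈ s.M x) : ∃ L, IsLastT (connected a (s.M x)) s.H L := by
  rcases hs.comp x a ha with ⟨-, h⟩ | ⟨t, l, hl, ⟨b, u, hb⟩, h⟩
  · refine ⟨none, ?_⟩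
    rintro ⟨t, k, -, b, c, u, hb, hc⟩
    have := TokenInst.mem_keys_of_evolvesTo hc
    simp [h b hb] at this
  · refine ⟨some (t, l), ⟨hl, _, b, u, hb, .refl _⟩, ?_⟩
    rintro ⟨t', k', hlt, -, c, d, v, hc, hd⟩
    exact absurd ((h c hc).1 k' (TokenInst.mem_keys_of_evolvesTo hd)) (by omega)

theorem keys_eq_empty (hs : N.Regular M₀ s) {x : P} {a : TokenInst A V} (ha : Item.tok a ∈ s.M x)
    (hL : IsLastT (connected a (s.M x)) s.H none) {b : TokenInst A V}
    (hb : Item.tok b ∈ connected a (s.M x)) : b.keys = ∅ := by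
  rcases hs.comp x a ha with ⟨-, h⟩ | ⟨t, l, hl, ⟨c, u, hc⟩, -⟩
  · exact h b hb
  · exact (hL ⟨t, l, hl, _, c, u, hc, .refl _⟩).elim

theorem keys_le (hs : N.Regular M₀ s) {x : P} {a : TokenInst A V} (ha : Item.tok a ∈ s.M x)
    {L : T × ℕ} (hL : IsLastT (connected a (s.M x)) s.H (some L)) {b : TokenInst A V}
    (hb : Item.tok b ∈ connected a (s.M x)) : ∀ l ∈ b.keys, l ≤ L.2 := by
  rcases hs.comp x a ha with ⟨-, h⟩ | ⟨t, l, hl, ⟨c, u, hc⟩, h⟩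
  · simp [h b hb]
  · intro l' hl'
    exact ((h b hb).1 l' hl').trans (not_lt.1 fun hlt => hL.2 ⟨t, l, hlt, hl, _, c, u, hc, .refl _⟩)

/-- The invariant `comp` names the last occurrence, which put the whole component into `x`;
uniqueness of the place comes from the ban on cloning variables. An untouched component is located
by the initial marking instead. -/
theorem isLastP_iff (hN : N.WellFormed) (hM₀ : N.IsInitialMarking M₀)
    (hs : N.Regular M₀ s) {x y : P}
    {a : TokenInst A V} (ha : Item.tok a ∈ s.M x) :
    N.IsLastP M₀ (connected a (s.M x)) s.H y ↔ y = x := by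
  have haC : Item.tok a ∈ connected a (s.M x) :=
    (tok_mem_connected (hs.graph x) ha).2 (Conn.refl _ _)
  rcases hs.comp x a ha with ⟨hC, h⟩ | ⟨t, l, hl, ⟨c, u, hc⟩, h⟩
  · have horig : ∀ e ∈ connected a (s.M x), e.map TokenInst.origin = e := fun e he =>
      Item.map_eq_self fun b hb => TokenInst.origin_eq_self <| h b <| by
        obtain ⟨he, d, hd, had⟩ := (mem_connected (hs.graph x) ha).1 he
        exact (tok_mem_connected (hs.graph x) ha).2 (had.trans (Conn.ends_ends he hd hb))
    have hnone : IsLastT (connected a (s.M x)) s.H none := by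
      rintro ⟨t, k, -, b, c, u, hb, hc⟩
      have := TokenInst.mem_keys_of_evolvesTo hc
      simp [h b hb] at this
    constructor
    · rintro (⟨t, l, ⟨hm, -⟩, -⟩ | ⟨-, hy⟩)
      · exact (hnone ⟨t, l, hm⟩).elim
      · have := hy _ haC
        rw [horig _ haC] at this
        exact hM₀.2.1 y x a this (hC haC)
    · rintro rfl
      refine Or.inr ⟨hnone, fun e he => ?_⟩
      rw [horig e he]
      exact hC he
  · have hlast : IsLastT (connected a (s.M x)) s.H (some (t, l)) := by
      refine ⟨⟨hl, _, c, u, hc, .refl _⟩, ?_⟩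
      rintro ⟨t', k', hlt, -, c, d, v, hc, hd⟩
      exact absurd ((h c hc).1 k' (TokenInst.mem_keys_of_evolvesTo hd)) (by omega)
    constructor
    · rintro (⟨t', l', hL, hset⟩ | ⟨hnone, -⟩)
      · have hle : ¬ l' < l := fun hlt => hL.2 ⟨t, l, hlt, hlast.1⟩
        have hge : ¬ l < l' := fun hlt => hlast.2 ⟨t', l', hlt, hL.1⟩
        obtain rfl : l' = l := by omega
        obtain rfl := hs.hist t' t l' hL.1.1 hl
        exact (hset.le ⟨_, c, u, hc, .refl _, (h _ hc).2 c u (.refl _)⟩ : x = y).symm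
      · exact (hnone ⟨t, l, hlast.1⟩).elim
    · rintro rfl
      refine Or.inl ⟨t, l, hlast, Set.Subset.antisymm ?_ ?_⟩
      · rintro z ⟨a', b, v, ha', hb, hv⟩
        by_contra hne
        exact (hN t).2 z y v hne ⟨hv, (h a' ha').2 b v hb⟩
      · rintro _ rfl
        exact ⟨_, c, u, hc, .refl _, (h _ hc).2 c u (.refl _)⟩

end Regular

namespace Undoable

open Classical in
/-- The token in the state after the occurrence that corresponds to one before it. -/
noncomputable def redo (N : MRPN P T A V) (t : T) (k : ℕ) (U : V → TokenInst A V)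
    (W : Set (Item (TokenInst A V))) (a : TokenInst A V) : TokenInst A V :=
  if Item.tok a ∈ W then N.extend t k U a else a

theorem redo_of_mem {a : TokenInst A V} (h : Item.tok a ∈ W) :
    redo N t k U W a = N.extend t k U a := if_pos h

theorem redo_of_not_mem {a : TokenInst A V} (h : Item.tok a ∉ W) : redo N t k U W a = a :=
  if_neg h

theorem origin_redo (a : TokenInst A V) : (redo N t k U W a).origin = a.origin := by
  unfold redo
  split_ifs <;> rfl

theorem forget_redo {a : TokenInst A V} (h : k ∉ a.keys) : (redo N t k U W a).forget k = a := by
  unfold redo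
  split_ifs
  · exact TokenInst.forget_step h _
  · exact TokenInst.forget_eq_self h

theorem evolvesTo_redo {a b : TokenInst A V} {l : ℕ} {u : Option V} (h : l ≠ k) :
    (TokenInst.step b l u).EvolvesTo (redo N t k U W a) ↔ (TokenInst.step b l u).EvolvesTo a := by
  unfold redo
  split_ifs
  · rw [extend, TokenInst.evolvesTo_step]
    simp [h]
  · rfl

/-- The memory `k` added by `redo` is outermost. It is cut off by the truncation if `k > l` and by
`forget` if `k ≤ l`; no other memory is affected. -/
theorem truncate_forget_redo {a : TokenInst A V} {l : ℕ} (h : k ∉ a.keys)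
    (hl : ∀ l' ∈ a.keys, l' ≤ l) : ((redo N t k U W a).truncate l).forget k = a := by
  unfold redo
  split_ifs
  · by_cases hkl : k ≤ l
    · rw [extend, TokenInst.truncate, if_pos hkl]
      exact TokenInst.forget_step h _
    · rw [extend, TokenInst.truncate, if_neg hkl, TokenInst.truncate_eq_self hl]
      exact TokenInst.forget_eq_self h
  · rw [TokenInst.truncate_eq_self hl]
    exact TokenInst.forget_eq_self h

theorem manipulates_redo {C : Set (Item (TokenInst A V))} {H : History T} (hH : ∀ t', k ∉ H t')
    (t' : T) (l : ℕ) : Manipulates (Item.map (redo N t k U W) '' C) H t' l ↔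
      Manipulates C H t' l := by
  refine and_congr_right fun hl => ?_
  have hne : l ≠ k := by rintro rfl; exact hH t' hl
  constructor
  · rintro ⟨_, b, u, h, hb⟩
    obtain ⟨a, ha, rfl⟩ := Item.tok_mem_map_image.1 h
    exact ⟨a, b, u, ha, (evolvesTo_redo hne).1 hb⟩
  · rintro ⟨a, b, u, ha, hb⟩
    exact ⟨_, b, u, ⟨_, ha, rfl⟩, (evolvesTo_redo hne).2 hb⟩

/-- Only memories whose keys occur in the history count, and `redo` adds none but `k`. -/
theorem isLastT_redo {C : Set (Item (TokenInst A V))} {H : History T} (hH : ∀ t', k ∉ H t')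
    (L : Option (T × ℕ)) : IsLastT (Item.map (redo N t k U W) '' C) H L ↔ IsLastT C H L := by
  cases L <;> simp only [IsLastT, manipulates_redo hH]

theorem isLastP_redo {C : Set (Item (TokenInst A V))} {H : History T} (hH : ∀ t', k ∉ H t')
    (x : P) : N.IsLastP M₀ (Item.map (redo N t k U W) '' C) H x ↔ N.IsLastP M₀ C H x := by
  unfold IsLastP
  simp only [isLastT_redo hH]
  refine or_congr ?_ (and_congr_right fun _ => ?_)
  · refine exists_congr fun t' => exists_congr fun l => and_congr_right fun hL => ?_
    have hne : l ≠ k := by rintro rfl; exact hH t' hL.1.1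
    have hset : {y | ∃ a b u, Item.tok a ∈ Item.map (redo N t k U W) '' C ∧
          (TokenInst.step b l (some u)).EvolvesTo a ∧ Item.tok u ∈ N.arcOut t' y} =
        {y | ∃ a b u, Item.tok a ∈ C ∧
          (TokenInst.step b l (some u)).EvolvesTo a ∧ Item.tok u ∈ N.arcOut t' y} := by
      ext y
      constructor
      · rintro ⟨_, b, u, h, hb, hu⟩
        obtain ⟨a, ha, rfl⟩ := Item.tok_mem_map_image.1 h
        exact ⟨a, b, u, ha, (evolvesTo_redo hne).1 hb, hu⟩
      · rintro ⟨a, b, u, ha, hb, hu⟩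
        exact ⟨_, b, u, ⟨_, ha, rfl⟩, (evolvesTo_redo hne).2 hb, hu⟩
    rw [hset]
  · rw [Set.forall_mem_image]
    simp only [Item.map_map, Function.comp_def, origin_redo]

theorem map_redo_of_not_mem (hu : Undoable N M₀ s t k U W W') {x : P}
    {e : Item (TokenInst A V)} (he : e ∈ s.M x) (hn : e ∉ N.newPart t k U W' x) :
    e.map (redo N t k U W) = e :=
  Item.map_eq_self fun a ha => redo_of_not_mem (hu.old_disjoint x e he hn a ha)

theorem map_redo_of_mem (hu : Undoable N M₀ s t k U W W') {e : Item (TokenInst A V)}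
    (he : e ∈ W) : e.map (redo N t k U W) = e.map (N.extend t k U) :=
  Item.map_congr fun a ha => redo_of_mem (hu.firing.switch.graph e he a ha)

/-- No token of the unfired state carries `k`, so `forget k` is a left inverse there. -/
theorem redo_injOn (hM₀ : N.IsInitialMarking M₀) (hu : Undoable N M₀ s t k U W W')
    (hs : N.Regular M₀ s) (hk : k ∈ s.H t) :
    Set.InjOn (redo N t k U W) {a | Item.tok a ∈ ⋃ x, (N.unfire s t k U W W').M x} := by
  intro a ha b hb h
  obtain ⟨x, hx⟩ := Set.mem_iUnion.1 ha
  obtain ⟨y, hy⟩ := Set.mem_iUnion.1 hb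
  rw [← forget_redo (hu.not_mem_keys_of_unfire hM₀ hs hk hx), h, forget_redo (hu.not_mem_keys_of_unfire hM₀ hs hk hy)]

theorem iUnion_connected (hs : N.Regular M₀ s) :
    {e | ∃ c z, e ∈ connected c (s.M z)} = ⋃ z, s.M z := by
  ext e
  constructor
  · rintro ⟨c, z, h⟩
    exact Set.mem_iUnion.2 ⟨z, connected_subset (hs.graph z) c h⟩
  · intro he
    obtain ⟨z, hz⟩ := Set.mem_iUnion.1 he
    obtain ⟨a, ha⟩ := e.ends_nonempty
    exact ⟨a, z, (mem_connected (hs.graph z) (hs.graph z e hz a ha)).2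
      ⟨hz, a, ha, Conn.refl _ _⟩⟩

/-- Undoing the exchange of labels yields the items before the occurrence, up to memories. -/
theorem exchange_eq (hu : Undoable N M₀ s t k U W W') (hs : N.Regular M₀ s)
    (hU' : ∀ u, Item.tok u ∈ N.guard t → U' u = N.extend t k U (U u)) :
    ({e | ∃ c z, e ∈ connected c (s.M z)} \ N.post t U') ∪ N.pre t U' =
      Item.map (redo N t k U W) '' ⋃ x, (N.unfire s t k U W W').M x := by
  rw [iUnion_connected hs, hu.post_eq hU', pre_eq_image hU']
  have hW : ∀ e ∈ W, e.map (N.extend t k U) ∈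
      Item.map (redo N t k U W) '' ⋃ x, (N.unfire s t k U W W').M x := by
    intro e he
    obtain ⟨x, hx⟩ := hu.firing.exists_inPart he
    exact ⟨e, Set.mem_iUnion.2 ⟨x, Or.inr hx⟩, hu.map_redo_of_mem he⟩
  have hpost : N.post t U ⊆ W' := hu.firing.switch.symm.pre_subset
  have hinj : Function.Injective (Item.map (N.extend t k U)) :=
    Item.map_injective extend_injective
  ext e
  constructor
  · rintro (⟨he, hne⟩ | ⟨e, he, rfl⟩)
    · obtain ⟨x, hx⟩ := Set.mem_iUnion.1 he
      by_cases hn : e ∈ N.newPart t k U W' x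
      · obtain ⟨e, he', rfl⟩ := hn
        refine hW e ?_
        rw [hu.firing.switch.eq]
        exact Or.inl ⟨reach_subset _ _ he', fun h => hne ⟨e, h, rfl⟩⟩
      · exact ⟨e, Set.mem_iUnion.2 ⟨x, Or.inl ⟨hx, hn⟩⟩, hu.map_redo_of_not_mem hx hn⟩
    · exact hW e (hu.firing.switch.pre_subset he)
  · rintro ⟨e, he, rfl⟩
    obtain ⟨x, ⟨hx, hn⟩ | hx⟩ := Set.mem_iUnion.1 he
    · rw [hu.map_redo_of_not_mem hx hn]
      exact Or.inl ⟨Set.mem_iUnion.2 ⟨x, hx⟩,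
        fun h => hn (hu.mem_newPart hs hx (Set.image_mono hpost h))⟩
    · have heW : e ∈ W := reach_subset _ _ hx
      rw [hu.map_redo_of_mem heW]
      rw [hu.firing.switch.eq] at heW
      rcases heW with ⟨heW, hne⟩ | heW
      · refine Or.inl ⟨hu.image_subset ⟨e, heW, rfl⟩, ?_⟩
        rintro ⟨e', he', h⟩
        obtain rfl := hinj h
        exact hne he'
      · exact Or.inr ⟨e, heW, rfl⟩

/-- Components in the union of all unfired places are components of single places, and `redo` is
injective on the tokens involved. -/
theorem component_redo (hM₀ : N.IsInitialMarking M₀) (hu : Undoable N M₀ s t k U W W')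
    (hs : N.Regular M₀ s) (hk : k ∈ s.H t)
    (hU' : ∀ u, Item.tok u ∈ N.guard t → U' u = N.extend t k U (U u)) {x : P} {a : TokenInst A V}
    (ha : Item.tok a ∈ (N.unfire s t k U W W').M x) :
    N.component s t U' (redo N t k U W a) =
      Item.map (redo N t k U W) '' connected a ((N.unfire s t k U W W').M x) := by
  have hr := hu.gapped.regular hM₀
  have hgraph := IsGraph.iUnion hr.graph
  have haU : Item.tok a ∈ ⋃ x, (N.unfire s t k U W W').M x := Set.mem_iUnion.2 ⟨x, ha⟩
  rw [component, hu.exchange_eq hs hU', connected_map hgraph (hu.redo_injOn hM₀ hs hk) haU]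
  congr 1
  refine connected_congr hgraph (hr.graph x) haU ha (hr.graph x) (Set.subset_iUnion _ x)
    subset_rfl ha ?_ fun _ _ h _ => h
  intro b c hbc hb
  obtain ⟨y, hy⟩ := Set.mem_iUnion.1 hbc
  rwa [hr.uniq x y b hb (hr.graph y _ hy b (by simp))]

/-- Each token after the occurrence corresponds to one before it. -/
theorem exists_redo_eq (hu : Undoable N M₀ s t k U W W') {y : P} {a : TokenInst A V}
    (ha : Item.tok a ∈ s.M y) :
    ∃ b x, Item.tok b ∈ (N.unfire s t k U W W').M x ∧ redo N t k U W b = a := by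
  by_cases hn : Item.tok a ∈ N.newPart t k U W' y
  · obtain ⟨b, -, hb, rfl⟩ := hu.firing.tok_mem_of_newPart hn
    obtain ⟨x, hx⟩ := hu.firing.exists_inPart hb
    exact ⟨b, x, Or.inr hx, redo_of_mem hb⟩
  · exact ⟨a, y, Or.inl ⟨ha, hn⟩, redo_of_not_mem (hu.old_disjoint y _ ha hn a rfl)⟩

theorem redo_mem (hu : Undoable N M₀ s t k U W W') {x : P} {a : TokenInst A V}
    (ha : Item.tok a ∈ (N.unfire s t k U W W').M x) :
    ∃ y, Item.tok (redo N t k U W a) ∈ s.M y := by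
  rcases ha with ⟨ha, hn⟩ | ha
  · rw [redo_of_not_mem (hu.old_disjoint x _ ha hn a rfl)]
    exact ⟨x, ha⟩
  · have haW : Item.tok a ∈ W := reach_subset _ _ ha
    rw [redo_of_mem haW]
    exact Set.mem_iUnion.1
      (hu.image_subset ⟨Item.tok a, (hu.firing.switch.tok_mem_iff a).1 haW, rfl⟩)

theorem lastA_redo (hM₀ : N.IsInitialMarking M₀) (hu : Undoable N M₀ s t k U W W')
    (hs : N.Regular M₀ s) (hk : k ∈ s.H t) {x : P} {a b : TokenInst A V}
    (ha : Item.tok a ∈ (N.unfire s t k U W W').M x) {L : Option (T × ℕ)}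
    (hL : IsLastT (connected a ((N.unfire s t k U W W').M x)) (revHistory s.H t k) L)
    (hb : Item.tok b ∈ connected a ((N.unfire s t k U W W').M x)) :
    lastA L k (redo N t k U W b) = b := by
  have hr := hu.gapped.regular hM₀
  have hkb : k ∉ b.keys := hu.not_mem_keys_of_unfire hM₀ hs hk (connected_subset (hr.graph x) a hb)
  cases L with
  | none =>
    change (redo N t k U W b).origin = b
    rw [origin_redo, TokenInst.origin_eq_self (hr.keys_eq_empty ha hL hb)]
  | some L => exact truncate_forget_redo hkb (hr.keys_le ha hL hb)

theorem not_mem_revHistory (hs : N.Regular M₀ s) (hk : k ∈ s.H t) (t' : T) :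
    k ∉ revHistory s.H t k t' := fun h => h.2 ⟨hs.hist t' t k h.1 hk, rfl⟩

/-- Every component, affected or not, is put into its last place with updated memories. This alone
rebuilds the whole unfired marking. -/
theorem oOut_eq (hN : N.WellFormed) (hM₀ : N.IsInitialMarking M₀)
    (hu : Undoable N M₀ s t k U W W')
    (hs : N.Regular M₀ s) (hk : k ∈ s.H t)
    (hU' : ∀ u, Item.tok u ∈ N.guard t → U' u = N.extend t k U (U u)) (x : P) :
    N.oOut M₀ s t k U' x = (N.unfire s t k U W W').M x := by
  have hr := hu.gapped.regular hM₀
  have hH := not_mem_revHistory hs hk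
  have hlast : ∀ {y a L e}, Item.tok a ∈ (N.unfire s t k U W W').M y →
      IsLastT (connected a ((N.unfire s t k U W W').M y)) (revHistory s.H t k) L →
      e ∈ connected a ((N.unfire s t k U W W').M y) →
      (e.map (redo N t k U W)).map (lastA L k) = e := by
    intro y a L e ha hL he
    rw [Item.map_map]
    refine Item.map_eq_self fun b hb => hu.lastA_redo hM₀ hs hk ha hL ?_
    obtain ⟨he, d, hd, had⟩ := (mem_connected (hr.graph y) ha).1 he
    exact (tok_mem_connected (hr.graph y) ha).2 (had.trans (Conn.ends_ends he hd hb))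
  ext e
  constructor
  · rintro ⟨a, y, L, ha, hL, hP, he⟩
    obtain ⟨b, z, hb, rfl⟩ := hu.exists_redo_eq ha
    rw [hu.component_redo hM₀ hs hk hU' hb] at hL hP he
    rw [isLastT_redo hH] at hL
    rw [isLastP_redo hH] at hP
    obtain rfl := (hr.isLastP_iff hN hM₀ hb).1 hP
    obtain ⟨_, ⟨e, he, rfl⟩, rfl⟩ := he
    rw [hlast hb hL he]
    exact connected_subset (hr.graph x) b he
  · intro he
    obtain ⟨a, ha⟩ := e.ends_nonempty
    have hax := hr.graph x e he a ha
    obtain ⟨L, hL⟩ := hr.exists_isLastT hax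
    obtain ⟨y, hy⟩ := hu.redo_mem hax
    have hea : e ∈ connected a ((N.unfire s t k U W W').M x) :=
      (mem_connected (hr.graph x) hax).2 ⟨he, a, ha, Conn.refl _ _⟩
    refine ⟨_, y, L, hy, ?_⟩
    rw [hu.component_redo hM₀ hs hk hU' hax, isLastT_redo hH, isLastP_redo hH]
    exact ⟨hL, (hr.isLastP_iff hN hM₀ hax).2 rfl, _, ⟨e, hea, rfl⟩, hlast hax hL hea⟩

/-- An item of the new part is either selected or in a component with a token carrying `k`, and the
update changes that token by erasing `k`. -/
theorem newPart_subset_oIn (hM₀ : N.IsInitialMarking M₀) (hu : Undoable N M₀ s t k U W W')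
    (hs : N.Regular M₀ s) (hk : k ∈ s.H t)
    (hU' : ∀ u, Item.tok u ∈ N.guard t → U' u = N.extend t k U (U u)) (x : P) :
    N.newPart t k U W' x ⊆ N.oIn M₀ s t k U' x := by
  intro e he
  by_cases hpost : e ∈ N.post t U'
  · exact Or.inl hpost
  have hr := hu.gapped.regular hM₀
  have hH := not_mem_revHistory hs hk
  obtain ⟨a, ha⟩ := e.ends_nonempty
  have han := hu.firing.isGraph_newPart k x e he a ha
  obtain ⟨b, -, hbW, rfl⟩ := hu.firing.tok_mem_of_newPart han
  obtain ⟨z, hz⟩ := hu.firing.exists_inPart hbW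
  have hbz : Item.tok b ∈ (N.unfire s t k U W W').M z := Or.inr hz
  have hredo : redo N t k U W b = N.extend t k U b := redo_of_mem hbW
  have hcomp := hu.component_redo hM₀ hs hk hU' hbz
  rw [hredo] at hcomp
  have hgraph : IsGraph (({e | ∃ c z, e ∈ connected c (s.M z)} \ N.post t U') ∪ N.pre t U') := by
    rw [hu.exchange_eq hs hU']
    exact (IsGraph.iUnion hr.graph).map _
  have heD : e ∈ ({e | ∃ c z, e ∈ connected c (s.M z)} \ N.post t U') ∪ N.pre t U' := by
    refine Or.inl ⟨?_, hpost⟩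
    rw [iUnion_connected hs]
    exact Set.mem_iUnion.2 ⟨x, hu.new_subset x he⟩
  have haD := hgraph e heD _ ha
  obtain ⟨L, hL⟩ := hr.exists_isLastT hbz
  refine Or.inr ⟨_, hu.new_subset x han, (mem_connected hgraph haD).2 ⟨heD, _, ha, Conn.refl _ _⟩,
    Or.inr ⟨L, ?_, N.extend t k U b, (tok_mem_connected hgraph haD).2 (Conn.refl _ _), ?_⟩⟩
  · rw [hcomp, isLastT_redo hH]
    exact hL
  · rw [← hredo, hu.lastA_redo hM₀ hs hk hbz hL
      ((tok_mem_connected (hr.graph z) hbz).2 (Conn.refl _ _)), hredo]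
    intro h
    have hkb := mem_keys_extend (N := N) (t := t) (k := k) (U := U) b
    rw [← h] at hkb
    exact hu.not_mem_keys hM₀ hs hk hbW hkb

/-- Removing too much is harmless, because `oOut` restores everything; it only matters that the new
part is removed. -/
theorem oMarking_eq (hN : N.WellFormed) (hM₀ : N.IsInitialMarking M₀)
    (hu : Undoable N M₀ s t k U W W')
    (hs : N.Regular M₀ s) (hk : k ∈ s.H t)
    (hU' : ∀ u, Item.tok u ∈ N.guard t → U' u = N.extend t k U (U u)) (x : P) :
    (s.M x \ N.oIn M₀ s t k U' x) ∪ N.oOut M₀ s t k U' x = (N.unfire s t k U W W').M x := by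
  rw [hu.oOut_eq hN hM₀ hs hk hU']
  refine Set.union_eq_right.2 fun e he => Or.inl ⟨he.1, fun h => he.2 ?_⟩
  exact hu.newPart_subset_oIn hM₀ hs hk hU' x h

end Undoable

/-! ### Comparison of the three reversals. -/

theorem Gapped.exists_undoable (hM₀ : N.IsInitialMarking M₀) (h : N.Gapped M₀ s)
    (hc : Occurs s t k ∧ ¬ ∃ t' k', CausallyPrecedes s t k t' k') :
    ∃ U W W', Undoable N M₀ s t k U W W' := by
  refine h.undoable hM₀ t k hc.1 fun x a ha hka l hl => not_lt.1 fun hlt => hc.2 ?_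
  obtain ⟨t', ht'⟩ := (h.regular hM₀).keys x a ha l hl
  exact ⟨t', l, hc.1, ht', hlt, x, a, ha, hka, hl⟩

theorem Gapped.cStep (hM₀ : N.IsInitialMarking M₀) (h : N.Gapped M₀ s)
    (hstep : N.CStep s t k s') : N.Gapped M₀ s' := by
  obtain ⟨U', hU', hM, hH⟩ := hstep
  obtain ⟨U, W, W', hu⟩ := h.exists_undoable hM₀ hU'.1
  have hs := h.regular hM₀
  have : s' = N.unfire s t k U W W' := by
    apply State.ext
    · rw [hM]
      exact hu.revMarking_eq hs (hu.revAssignment_eq hM₀ hs hU'.1.1 hU'.2)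
    · exact hH
  rw [this]
  exact hu.gapped

theorem Reachable.gapped (hM₀ : N.IsInitialMarking M₀) (hN : N.WellFormed)
    (h : N.Reachable M₀ s) : N.Gapped M₀ s := by
  induction h with
  | refl => exact .init
  | tail _ hstep ih =>
    obtain ⟨t, k, hstep | hstep⟩ := hstep
    · exact ih.fwdStep hM₀ hN hstep
    · exact ih.cStep hM₀ hstep

theorem cStep_iff_oStep (hM₀ : N.IsInitialMarking M₀) (hN : N.WellFormed)
    (h : N.Reachable M₀ s) (hc : N.CEnabled s t k) : N.CStep s t k s' ↔ N.OStep M₀ s t k s' := by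
  have hg := h.gapped hM₀ hN
  have hs := hg.regular hM₀
  obtain ⟨U₁, hU₁⟩ := hc
  obtain ⟨U, W, W', hu⟩ := hg.exists_undoable hM₀ hU₁.1
  constructor
  · rintro ⟨U', hU', hM, hH⟩
    have hagree := hu.revAssignment_eq hM₀ hs hU'.1.1 hU'.2
    refine ⟨U', hU'.oAssignment hN, fun x => ?_, hH⟩
    rw [hM, hu.revMarking_eq hs hagree, hu.oMarking_eq hN hM₀ hs hU'.1.1 hagree]
  · rintro ⟨U', hU', hM, hH⟩
    -- The assignment `U'` is discarded in favour of the one that makes `(t, k)` c-enabled: both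
    -- lead to the same unfired marking.
    refine ⟨U₁, hU₁, funext fun x => ?_, hH⟩
    rw [hM x, hu.oMarking_eq hN hM₀ hs hU'.1 (hu.oAssignment_eq hM₀ hs hU'),
      hu.revMarking_eq hs (hu.revAssignment_eq hM₀ hs hU₁.1.1 hU₁.2)]

theorem BtAssignment.cAssignment (hU : N.BtAssignment s t k U) : N.CAssignment s t k U := by
  refine ⟨⟨hU.1.1, ?_⟩, hU.2⟩
  rintro ⟨t', k', -, hk', hlt, -⟩
  exact absurd (hU.1.2 t' k' hk') (by omega)

theorem BtStep.cStep (h : N.BtStep s t k s') : N.CStep s t k s' := by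
  obtain ⟨U, hU, h⟩ := h
  exact ⟨U, hU.cAssignment, h⟩

theorem btStep_iff_cStep (hb : N.BtEnabled s t k) : N.BtStep s t k s' ↔ N.CStep s t k s' := by
  refine ⟨BtStep.cStep, ?_⟩
  rintro ⟨U, hU, h⟩
  obtain ⟨_, hU', -⟩ := hb
  exact ⟨U, ⟨hU', hU.2⟩, h⟩

end MRPN

namespace MRPN

/-! ### The inclusions are strict -/

/-- A net in which tokens move from place `0` to place `1` and from there to place `2`. -/
def chain : MRPN (Fin 3) (Fin 2) Unit Unit where
  type := id
  B := ∅
  arcIn x t := {e | x = t.castSucc ∧ e = Item.tok ()}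
  arcOut t x := {e | x = t.succ ∧ e = Item.tok ()}
  arcIn_bond := by simp
  arcOut_bond := by simp

/-- The state with given tokens, without bonds. -/
def tokState (S : Fin 3 → Set (TokenInst Unit Unit)) (H : History (Fin 2)) :
    State (Fin 3) (Fin 2) Unit Unit := ⟨fun x => Item.tok '' S x, H⟩

/-- The token `a` moves along `t`, with key `k`. -/
def moveTok (S : Fin 3 → Set (TokenInst Unit Unit)) (t : Fin 2) (k : ℕ) (a : TokenInst Unit Unit) :
    Fin 3 → Set (TokenInst Unit Unit) :=
  fun x => {b | b ∈ S x ∧ ¬ (x = t.castSucc ∧ b = a)} ∪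
    {b | x = t.succ ∧ b = TokenInst.step a k (some ())}

/-- Two tokens in place `0`. -/
def twoTok : Fin 3 → Set (TokenInst Unit Unit) :=
  fun x => {a | x = 0 ∧ (a = TokenInst.init () 0 ∨ a = TokenInst.init () 1)}

theorem chain_wellFormed : chain.WellFormed := by
  intro t
  constructor
  · intro u
    simp [guard, effects, chain]
  · rintro x y u hxy ⟨⟨rfl, -⟩, rfl, -⟩
    exact hxy rfl

theorem twoTok_isInitialMarking : chain.IsInitialMarking fun x => Item.tok '' twoTok x := by
  refine ⟨?_, ?_, ?_⟩
  · rintro x a ⟨b, ⟨-, rfl | rfl⟩, h⟩ <;> cases h <;> exact ⟨_, _, rfl⟩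
  · rintro x y a ⟨b, ⟨rfl, -⟩, -⟩ ⟨c, ⟨rfl, -⟩, -⟩
    rfl
  · rintro x a b ⟨c, -, h⟩
    cases h

theorem connected_image_tok {X : Type*} {S : Set X} {a : X} (ha : a ∈ S) :
    connected a (Item.tok '' S) = {Item.tok a} := by
  ext e
  constructor
  · rintro (⟨rfl, -⟩ | ⟨b, c, -, ⟨⟨d, -, h⟩, -⟩, -⟩)
    · rfl
    · cases h
  · rintro rfl
    exact Or.inl ⟨rfl, a, ha, rfl⟩

theorem chain_pre (t : Fin 2) (a : TokenInst Unit Unit) :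
    chain.pre t (fun _ => a) = {Item.tok a} := by
  ext e
  simp [pre, guard, chain, eq_comm]

theorem chain_post (t : Fin 2) (a : TokenInst Unit Unit) :
    chain.post t (fun _ => a) = {Item.tok a} := by
  ext e
  simp [post, effects, chain, eq_comm]

theorem chain_exchange (S : Set (TokenInst Unit Unit)) (t : Fin 2) (a : TokenInst Unit Unit) :
    (Item.tok '' S \ chain.pre t fun _ => a) ∪ (chain.post t fun _ => a) =
      Item.tok '' (insert a S) := by
  rw [chain_pre, chain_post, Set.image_insert_eq, Set.sdiff_union_self, Set.union_comm,
    Set.singleton_union]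

theorem chain_fwdStep {S : Fin 3 → Set (TokenInst Unit Unit)} {H : History (Fin 2)} {t : Fin 2}
    {m : ℕ} {a : TokenInst Unit Unit} (ha : a ∈ S t.castSucc)
    (hm : IsGreatest ({0} ∪ {l | ∃ t', l ∈ H t'}) m) :
    chain.FwdStep (tokState S H) t (m + 1) (tokState (moveTok S t (m + 1) a)
      fun t' => {l | l ∈ H t' ∨ (t' = t ∧ l = m + 1)}) := by
  refine ⟨⟨m, hm, rfl⟩, ⟨fun _ => a, ⟨fun _ _ _ _ _ => rfl, ?_, ?_, ?_, ?_⟩, fun x => ?_⟩,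
    fun _ _ => Iff.rfl⟩
  · rintro x u ⟨rfl, -⟩
    exact ⟨⟨a, ha, rfl⟩, rfl⟩
  · rintro x u v ⟨-, h⟩
    cases h
  · rintro x u v - - ⟨c, -, h⟩
    cases h
  · rintro y₁ y₂ u v ⟨rfl, -⟩ ⟨rfl, -⟩ h
    exact (h rfl).elim
  · have hin : chain.fwdIn (tokState S H) t (fun _ => a) x =
        {e | x = t.castSucc ∧ e = Item.tok a} := by
      ext e
      constructor
      · rintro ⟨u, ⟨rfl, -⟩, he⟩
        rw [tokState, connected_image_tok ha] at he
        exact ⟨rfl, he⟩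
      · rintro ⟨rfl, rfl⟩
        refine ⟨(), ⟨rfl, rfl⟩, ?_⟩
        rw [tokState, connected_image_tok ha]
        rfl
    have hout : chain.fwdOut (tokState S H) t (fun _ => a) x =
        {e | x = t.succ ∧ e = Item.tok a} := by
      ext e
      constructor
      · rintro ⟨u, y, ⟨rfl, -⟩, -, he⟩
        rw [tokState, chain_exchange, connected_image_tok (Set.mem_insert _ _)] at he
        exact ⟨rfl, he⟩
      · rintro ⟨rfl, rfl⟩
        refine ⟨(), t.castSucc, ⟨rfl, rfl⟩, ⟨a, ha, rfl⟩, ?_⟩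
        rw [tokState, chain_exchange, connected_image_tok (Set.mem_insert _ _)]
        rfl
    have hvar : chain.varOf t (fun _ => a) a = some () := by
      have h : ∃ u, Item.tok u ∈ chain.guard t ∧ (fun _ : Unit => a) u = a :=
        ⟨(), Set.mem_iUnion.2 ⟨t.castSucc, rfl, rfl⟩, rfl⟩
      rw [varOf, dif_pos h]
    rw [hin, hout]
    ext e
    constructor
    · rintro ⟨b, ⟨hb, hne⟩ | ⟨rfl, rfl⟩, rfl⟩
      · refine Or.inl ⟨⟨b, hb, rfl⟩, ?_⟩
        rintro ⟨rfl, h⟩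
        exact hne ⟨rfl, Item.tok.inj h⟩
      · exact Or.inr ⟨Item.tok a, ⟨rfl, rfl⟩, by simp only [Item.map_tok, hvar]⟩
    · rintro (⟨⟨b, hb, rfl⟩, hne⟩ | ⟨_, ⟨rfl, rfl⟩, rfl⟩)
      · refine ⟨b, Or.inl ⟨hb, ?_⟩, rfl⟩
        rintro ⟨rfl, rfl⟩
        exact hne ⟨rfl, rfl⟩
      · exact ⟨_, Or.inr ⟨rfl, rfl⟩, by simp only [Item.map_tok, hvar]⟩

/-- A token has moved along transition `0`, and then the token `a` along `t`. -/
def twoMoves (t : Fin 2) (a : TokenInst Unit Unit) : State (Fin 3) (Fin 2) Unit Unit :=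
  tokState (moveTok (moveTok twoTok 0 1 (TokenInst.init () 0)) t 2 a)
    fun t' => {l | (t' = 0 ∧ l = 1) ∨ (t' = t ∧ l = 2)}

theorem twoMoves_reachable {t : Fin 2} {a : TokenInst Unit Unit}
    (ha : a ∈ moveTok twoTok 0 1 (TokenInst.init () 0) t.castSucc) :
    chain.Reachable (fun x => Item.tok '' twoTok x) (twoMoves t a) := by
  have h₁ := chain_fwdStep (S := twoTok) (H := fun _ => ∅) (t := 0) (m := 0)
    (a := TokenInst.init () 0) ⟨rfl, Or.inl rfl⟩ (by simp)
  have h₂ := chain_fwdStep (S := moveTok twoTok 0 1 (TokenInst.init () 0))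
    (H := fun t' => {l | t' = 0 ∧ l = 1}) (t := t) (m := 1) ha (by
      constructor
      · exact Or.inr ⟨0, rfl, rfl⟩
      · rintro l (rfl | ⟨t', -, rfl⟩) <;> simp)
  refine Relation.ReflTransGen.tail (Relation.ReflTransGen.single ⟨0, 1, Or.inl ?_⟩)
    ⟨t, 2, Or.inl h₂⟩
  simpa [tokState, initialState] using h₁

theorem chain_cStep : ∃ s', chain.CStep (twoMoves 0 (TokenInst.init () 1)) 0 1 s' := by
  refine ⟨⟨_, _⟩, fun _ => TokenInst.step (TokenInst.init () 0) 1 (some ()),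
    ⟨⟨Or.inl ⟨rfl, rfl⟩, ?_⟩, fun _ _ _ _ _ => rfl, ?_, ?_⟩, rfl, rfl⟩
  -- The only later key is `2`, and it belongs to the other token, so no token carries both keys.
  · rintro ⟨t', k', -, hk', hlt, x, a, ⟨a, ha, h⟩, h1, h2⟩
    cases h
    obtain rfl : k' = 2 := by
      rcases hk' with ⟨-, rfl⟩ | ⟨-, rfl⟩
      · omega
      · rfl
    change 1 ∈ a.keys at h1
    change 2 ∈ a.keys at h2
    rcases ha with ⟨⟨⟨-, rfl | rfl⟩, -⟩ | ⟨-, rfl⟩, -⟩ | ⟨-, rfl⟩ <;> simp at h1 h2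
  · rintro x u ⟨rfl, -⟩
    exact ⟨⟨_, rfl⟩, ⟨_, Or.inl ⟨Or.inr ⟨rfl, rfl⟩, fun h => absurd h.1 (by decide)⟩, rfl⟩, rfl⟩
  · rintro x u v ⟨-, h⟩
    cases h

theorem chain_not_btStep (s' : State (Fin 3) (Fin 2) Unit Unit) :
    ¬ chain.BtStep (twoMoves 0 (TokenInst.init () 1)) 0 1 s' := by
  rintro ⟨U, ⟨⟨-, h⟩, -⟩, -⟩
  exact absurd (h 0 2 (Or.inr ⟨rfl, rfl⟩)) (by omega)

theorem chain_oStep : ∃ s', chain.OStep (fun x => Item.tok '' twoTok x)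
    (twoMoves 1 (TokenInst.step (TokenInst.init () 0) 1 (some ()))) 0 1 s' := by
  -- The target is whatever the definition of the reversal yields, so only enabledness is at stake.
  -- The token qualifies although `1` is not its outermost key, and without bonds the remaining
  -- clauses are vacuous.
  refine ⟨⟨_, _⟩,
    fun _ => TokenInst.step (TokenInst.step (TokenInst.init () 0) 1 (some ())) 2 (some ()),
    ⟨Or.inl ⟨rfl, rfl⟩, fun _ _ _ _ _ => rfl, ?_, ?_, ?_, ?_⟩, fun _ => rfl, rfl⟩
  · intro u _
    exact ⟨⟨_, .step _ _ (.refl _)⟩, ⟨2, _, Or.inr ⟨rfl, rfl⟩, rfl⟩, rfl⟩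
  all_goals
    intro u v huv
    obtain ⟨x, -, h⟩ := Set.mem_iUnion.1 huv
    cases h

theorem chain_not_cStep (s' : State (Fin 3) (Fin 2) Unit Unit) :
    ¬ chain.CStep (twoMoves 1 (TokenInst.step (TokenInst.init () 0) 1 (some ()))) 0 1 s' := by
  rintro ⟨U, ⟨⟨-, h⟩, -⟩, -⟩
  exact h ⟨1, 2, Or.inl ⟨rfl, rfl⟩, Or.inr ⟨rfl, rfl⟩, by omega, 2, _,
    ⟨_, Or.inr ⟨rfl, rfl⟩, rfl⟩, ⟨_, _, .step _ _ (.refl _)⟩, ⟨_, _, .refl _⟩⟩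

theorem btRel_subset_cRel {P T A V : Type*} (N : MRPN P T A V) (M₀ : Marking P A V) :
    N.btRel M₀ ⊆ N.cRel M₀ :=
  fun _ hr => ⟨hr.1, hr.2.cStep⟩

theorem cRel_subset_oRel {P T A V : Type*} {N : MRPN P T A V} {M₀ : Marking P A V}
    (hN : N.WellFormed) (hM₀ : N.IsInitialMarking M₀) : N.cRel M₀ ⊆ N.oRel M₀ := by
  rintro r ⟨hr, h⟩
  have hc : N.CEnabled r.1 r.2.1.1 r.2.1.2 := by
    obtain ⟨U, hU, -⟩ := h
    exact ⟨U, hU⟩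
  exact ⟨hr, (cStep_iff_oStep hM₀ hN hr hc).1 h⟩

end MRPN

theorem mainTheorem11 :
    (∀ (P : Type*) (T : Type*) (A : Type*) (V : Type*) [Finite P] [Finite T] [Finite A] [Finite V]
      (N : MRPN P T A V) (M₀ : MRPN.Marking P A V),
      N.WellFormed → N.IsInitialMarking M₀ →
      (∀ s, N.Reachable M₀ s → ∀ t k, N.CEnabled s t k →
        ∀ s', N.CStep s t k s' ↔ N.OStep M₀ s t k s') ∧
      (∀ s, N.Reachable M₀ s → ∀ t k, N.BtEnabled s t k →
        ∀ s', N.BtStep s t k s' ↔ N.OStep M₀ s t k s') ∧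
      N.btRel M₀ ⊆ N.cRel M₀ ∧ N.cRel M₀ ⊆ N.oRel M₀) ∧
    (∃ (P T A V : Type) (_ : Finite P) (_ : Finite T) (_ : Finite A) (_ : Finite V)
      (N : MRPN P T A V) (M₀ : MRPN.Marking P A V),
      N.WellFormed ∧ N.IsInitialMarking M₀ ∧
      N.btRel M₀ ⊂ N.cRel M₀ ∧ N.cRel M₀ ⊂ N.oRel M₀) := by
  constructor
  · intro P T A V _ _ _ _ N M₀ hN hM₀
    refine ⟨fun s hs t k hc s' => MRPN.cStep_iff_oStep hM₀ hN hs hc, fun s hs t k hb s' => ?_,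
      N.btRel_subset_cRel M₀, MRPN.cRel_subset_oRel hN hM₀⟩
    obtain ⟨U, hU⟩ := id hb
    rw [MRPN.btStep_iff_cStep hb]
    exact MRPN.cStep_iff_oStep hM₀ hN hs ⟨U, hU.cAssignment⟩
  · refine ⟨Fin 3, Fin 2, Unit, Unit, inferInstance, inferInstance, inferInstance, inferInstance,
      MRPN.chain, fun x => Item.tok '' MRPN.twoTok x, MRPN.chain_wellFormed,
      MRPN.twoTok_isInitialMarking, ⟨MRPN.btRel_subset_cRel _ _, fun h => ?_⟩,
      MRPN.cRel_subset_oRel MRPN.chain_wellFormed MRPN.twoTok_isInitialMarking, fun h => ?_⟩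
    -- The first of two independent moves: causally reversible, but not the latest.
    · obtain ⟨s', hs'⟩ := MRPN.chain_cStep
      have hr := MRPN.twoMoves_reachable (t := 0) (a := TokenInst.init () 1)
        (Or.inl ⟨⟨rfl, Or.inr rfl⟩, by simp⟩)
      exact MRPN.chain_not_btStep s' (h (a := (_, (0, 1), s')) ⟨hr, hs'⟩).2
    -- The first of two moves of the same token: the second move depends on it.
    · obtain ⟨s', hs'⟩ := MRPN.chain_oStep
      have hr := MRPN.twoMoves_reachable (t := 1)
        (a := TokenInst.step (TokenInst.init () 0) 1 (some ())) (Or.inr ⟨rfl, rfl⟩)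
      exact MRPN.chain_not_cStep s' (h (a := (_, (0, 1), s')) ⟨hr, hs'⟩).2
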